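/- **Setting.** Let $(\Omega,\mathcal F,\mathcal P)$ be a probability space, $\xi:\Omega\to\mathbb R^d$ a random variable, $\Xi:=\xi(\Omega)$, and let $\|\cdot\|$ be the Euclidean norm of vectors and the norm it induces on matrices. Let $T>0$, $\delta>0$, $A\in\mathbb R^{n\times n}$, $B\in\mathbb R^{n\times m}$, $C\in\mathbb R^{l\times n}$, $D\in\mathbb R^{l\times m}$, $x_0\in\mathbb R^n$, $f\in L^2(0,T)^l$, $x_d\in L^2(0,T)^n$, $u_d\in L^2(0,T)^m$, and let $K\subseteq\mathbb R^{\ell}$ be nonempty, closed and convex. The maps $F:\mathbb R^n\times\Xi\to\mathbb R$ and $g:\mathbb R^n\times\Xi\to\mathbb R^{\ell}$ are continuously differentiable on $\mathbb R^n$ for almost every $\xi\in\Xi$ and measurable on $\Xi$ for each $z\in\mathbb R^n$; $M:\Xi\to\mathbb R^{n\times n}$ and $q:\Xi\to\mathbb R^n$ are measurable. Consider the problem of minimizing $$\Phi(x,u)=\mathbb E[F(x(T),\xi)]+\tfrac12\|x-x_d\|_{L^2}^2+\tfrac{\delta}{2}\|u-u_d\|_{L^2}^2$$ over $(x,u)\in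 H^1(0,T)^n\times L^2(0,T)^m$ subject to $$\dot x(t)=Ax(t)+Bu(t),\qquad Cx(t)+Du(t)-f(t)\le 0\qquad\text{for a.e. }t\in(0,T),$$ $$0\le x(T)\perp\mathbb E[M(\xi)x(T)+q(\xi)]\ge 0,\qquad x(0)=x_0,\qquad \mathbb E[g(x(T),\xi)]\in K. \tag{P}$$ Here $\dot x$ is the weak derivative, and $x(0)$, $x(T)$ are values of the continuous representative of $x$ on $[0,T]$. A pair $(x,u)$ is feasible if it satisfies these constraints, and optimal if it is feasible and minimizes $\Phi$ over all feasible pairs. **Definitions.** A square real matrix $N$ is a Z-matrix if its off-diagonal entries are non-positive. It is column adequate if, for every $z$, $z_i(Nz)_i\le 0$ for all $i$ implies $Nz=0$; it is adequate if both $N$ and $N^\top$ are column adequate. Let $\mathcal J$ be the set of nonempty $J\subseteq\{1,\dots,n\}$ such that the principal submatrix $\mathbb E[M_{J,J}(\xi)]$ is nonsingular, and let $\beta=\max_{J\in\mathcal J}\|(\mathbb E[M_{J,J}(\xi)])^{-1}\|_1$ (maximal absolute column sum) if $\mathcal J\ne\emptyset$, and $\beta=1$ otherwise. **Theorem.** Assume: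 1. There are nonnegative measurable functions $\kappa_1,\dots,\kappa_4$ on $\Xi$ with $\mathbb E[\kappa_i(\xi)]<\infty$ such that for all $z_1,z_2\in\mathbb R^n$, $|F(z_1,\xi)-F(z_2,\xi)|\le\kappa_1(\xi)\|z_1-z_2\|$ and $\|g(z_1,\xi)\|\le\kappa_2(\xi)\|z_1\|$ for a.e. $\xi\in\Xi$, and $\|M(\xi)\|\le\kappa_3(\xi)$, $\|q(\xi)\|\le\kappa_4(\xi)$ for all $\xi\in\Xi$. 2. $l<m$, $D$ has full row rank, and, with $D^\dagger=D^\top(DD^\top)^{-1}$ and a matrix $Y\in\mathbb R^{m\times(m-l)}$ of full column rank such that $DY=0$, the matrix $$[\,BY\;\;(A-BD^\dagger C)BY\;\;\cdots\;\;(A-BD^\dagger C)^{n-1}BY\,]\in\mathbb R^{n\times n(m-l)}$$ has full row rank. 3. The closed ball of $\mathbb R^{\ell}$ with center $0$ and radius $\beta\,\mathbb E[\kappa_2(\xi)]\,\|\mathbb E[q(\xi)]\|_1$ is contained in $K$. 4. The set $\mathcal V=\{v\in\mathbb R^n: v\ge 0,\ \mathbb E[M(\xi)v+q(\xi)]\ge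 0\}$ is nonempty. 5. $\mathbb E[M(\xi)]$ is adequate or a Z-matrix. Then (P) has a feasible solution $(x,u)\in H^1(0,T)^n\times L^2(0,T)^m$. If, in addition, $F(z,\xi)$ is integrable for every $z\in\mathbb R^n$ and the function $z\mapsto\mathbb E[F(z,\xi)]$ is bounded from below on $\mathbb R^n$, then (P) has an optimal solution. -/

import Mathlib

open MeasureTheory Set

namespace TerminalSLCC

section FunctionSpaces

open scoped ContDiff

/-! ### The spaces `L²(0,T)ⁿ` and `H¹(0,T)ⁿ` -/

/-- `ℝⁿ` with the Euclidean norm. -/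
abbrev Vec (n : ℕ) : Type := EuclideanSpace ℝ (Fin n)

/-- Lebesgue measure on the open interval `(0,T)`. -/
noncomputable abbrev timeMeasure (T : ℝ) : Measure ℝ := volume.restrict (Ioo 0 T)

/-- `L²(0,T)ⁿ`, with its norm `(∫₀ᵀ ‖x(t)‖² dt)^(1/2)`. -/
abbrev L2 (T : ℝ) (n : ℕ) : Type := Lp (Vec n) 2 (timeMeasure T)

/-- `x'` is the weak derivative of `x` on `(0,T)`: componentwise integration by parts against
all smooth functions with compact support in `(0,T)`. -/
def IsWeakDeriv {T : ℝ} {n : ℕ} (x x' : L2 T n) : Prop :=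
  ∀ i : Fin n, ∀ φ : ℝ → ℝ, ContDiff ℝ ∞ φ → HasCompactSupport φ → tsupport φ ⊆ Ioo 0 T →
    ∫ t in Ioo 0 T, deriv φ t * x t i = -∫ t in Ioo 0 T, φ t * x' t i

/-- `H¹(0,T)ⁿ`: square integrable functions with a square integrable weak derivative. The
derivative is recorded with the function; it is unique (`H1.deriv_unique`). -/
structure H1 (T : ℝ) (n : ℕ) where
  toL2 : L2 T n
  deriv : L2 T n
  isWeakDeriv : IsWeakDeriv toL2 deriv

/-- A smooth function with support in a compact subinterval of `(0,T)` and zero integral is the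
derivative of a test function. -/
theorem primitive_test {T a b : ℝ} (ha : 0 < a) (hab : a ≤ b) (hb : b < T) {θ : ℝ → ℝ}
    (hθ : ContDiff ℝ ∞ θ) (hs : ∀ t, t ∉ Icc a b → θ t = 0) (hI : ∫ t in Ioo 0 T, θ t = 0) :
    ∃ φ : ℝ → ℝ, ContDiff ℝ ∞ φ ∧ HasCompactSupport φ ∧ tsupport φ ⊆ Ioo 0 T ∧ deriv φ = θ := by
  have hc := hθ.continuous
  have hi : ∀ u v : ℝ, IntervalIntegrable θ volume u v := fun u v => hc.intervalIntegrable u v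
  have hd : ∀ t, HasDerivAt (fun t => ∫ s in (0 : ℝ)..t, θ s) (θ t) t := fun t =>
    intervalIntegral.integral_hasDerivAt_right (hi _ _)
      (hc.stronglyMeasurableAtFilter _ _) hc.continuousAt
  have hderiv : deriv (fun t => ∫ s in (0 : ℝ)..t, θ s) = θ := funext fun t => (hd t).deriv
  have hT : ∫ s in (0 : ℝ)..T, θ s = 0 := by
    rw [intervalIntegral.integral_of_le (by linarith), integral_Ioc_eq_integral_Ioo, hI]
  have hsub : Function.support (fun t => ∫ s in (0 : ℝ)..t, θ s) ⊆ Icc a b := by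
    intro t ht
    by_contra hn
    apply ht
    rcases lt_or_ge t a with h | h
    · refine intervalIntegral.integral_zero_ae (.of_forall fun s hs' => hs s fun h' => ?_)
      rcases le_total 0 t with h0 | h0
      · rw [uIoc_of_le h0] at hs'; linarith [hs'.2, h'.1]
      · rw [uIoc_of_ge h0] at hs'; linarith [hs'.2, h'.1]
    · have htb : b < t := by
        by_contra h2
        exact hn ⟨h, not_lt.mp h2⟩
      have h3 : ∫ s in t..T, θ s = 0 := by
        refine intervalIntegral.integral_zero_ae (.of_forall fun s hs' => hs s fun h' => ?_)
        rcases le_total t T with h0 | h0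
        · rw [uIoc_of_le h0] at hs'; linarith [hs'.1, h'.2]
        · rw [uIoc_of_ge h0] at hs'; linarith [hs'.1, h'.2]
      have h4 := intervalIntegral.integral_add_adjacent_intervals (hi 0 t) (hi t T)
      show ∫ s in (0 : ℝ)..t, θ s = 0
      linarith
  have hts : tsupport (fun t => ∫ s in (0 : ℝ)..t, θ s) ⊆ Icc a b :=
    closure_minimal hsub isClosed_Icc
  refine ⟨_, contDiff_infty_iff_deriv.2 ⟨fun t => (hd t).differentiableAt, by rw [hderiv]; exact hθ⟩,
    HasCompactSupport.intro (isCompact_Icc (a := a) (b := b)) fun t ht => ?_, fun t ht => ?_, hderiv⟩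
  · by_contra h; exact ht (hsub h)
  · exact ⟨ha.trans_le (hts ht).1, (hts ht).2.trans_lt hb⟩

/-- The fundamental lemma: an integrable function with zero weak derivative is a.e. constant. -/
theorem ae_eq_const_of_weak {T : ℝ} (hT : 0 < T) {v : ℝ → ℝ} (hv : IntegrableOn v (Ioo 0 T))
    (h : ∀ φ : ℝ → ℝ, ContDiff ℝ ∞ φ → HasCompactSupport φ → tsupport φ ⊆ Ioo 0 T →
      ∫ t in Ioo 0 T, deriv φ t * v t = 0) :
    ∃ c : ℝ, ∀ᵐ t ∂(volume.restrict (Ioo 0 T)), v t = c := by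
  let f : ContDiffBump (T / 2) := ⟨T / 8, T / 4, by linarith, by linarith⟩
  let ψ : ℝ → ℝ := f.normed volume
  have hψs : tsupport ψ ⊆ Ioo 0 T := by
    intro t ht
    have : t ∈ Metric.closedBall (T / 2) (T / 4) := by
      have := f.tsupport_normed_eq (μ := volume)
      exact this ▸ ht
    rw [Real.closedBall_eq_Icc] at this
    constructor <;> linarith [this.1, this.2]
  have hψd : ContDiff ℝ ∞ ψ := f.contDiff_normed
  have hψc : HasCompactSupport ψ := f.hasCompactSupport_normed
  have hmul : ∀ η : ℝ → ℝ, Continuous η → HasCompactSupport η →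
      IntegrableOn (fun t => η t * v t) (Ioo 0 T) := by
    intro η hη hηc
    obtain ⟨C, hC⟩ := hηc.exists_bound_of_continuous hη
    exact hv.bdd_mul hη.aestronglyMeasurable (.of_forall hC)
  have hset : ∀ η : ℝ → ℝ, tsupport η ⊆ Ioo 0 T → ∫ t in Ioo 0 T, η t = ∫ t, η t := by
    intro η hη
    refine setIntegral_eq_integral_of_forall_compl_eq_zero fun t ht => ?_
    by_contra h0
    exact ht (hη (subset_tsupport _ h0))
  have hψ1 : ∫ t in Ioo 0 T, ψ t = 1 := by rw [hset ψ hψs]; exact f.integral_normed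
  set c := ∫ t in Ioo 0 T, ψ t * v t with hc
  refine ⟨c, ?_⟩
  have key : ∀ᵐ t ∂volume, t ∈ Ioo 0 T → v t - c = 0 := by
    refine isOpen_Ioo.ae_eq_zero_of_integral_contDiff_smul_eq_zero
      ((hv.sub (integrable_const c)).locallyIntegrableOn) fun η hη hηc hηs => ?_
    let I := ∫ t in Ioo 0 T, η t
    let K := tsupport η ∪ tsupport ψ
    have hK : IsCompact K := IsCompact.union hηc hψc
    have hKs : K ⊆ Ioo 0 T := union_subset hηs hψs
    have hKn : K.Nonempty := by
      refine ⟨T / 2, Or.inr ?_⟩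
      have := f.tsupport_normed_eq (μ := volume)
      show T / 2 ∈ tsupport (f.normed volume)
      rw [this]
      exact Metric.mem_closedBall_self (by show (0 : ℝ) ≤ T / 4; linarith)
    have hηi : IntegrableOn η (Ioo 0 T) := (hη.continuous.integrable_of_hasCompactSupport hηc).integrableOn
    have hψi : IntegrableOn ψ (Ioo 0 T) := (hψd.continuous.integrable_of_hasCompactSupport hψc).integrableOn
    obtain ⟨φ, h1, h2, h3, h4⟩ := primitive_test (T := T) (a := sInf K) (b := sSup K)
      (θ := fun t => η t - I * ψ t) (hKs (hK.sInf_mem hKn)).1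
      (le_csSup hK.bddAbove (hK.sInf_mem hKn)) (hKs (hK.sSup_mem hKn)).2
      (hη.sub (contDiff_const.mul hψd)) (fun t ht => by
        have ht' : t ∉ K := fun h' => ht ⟨csInf_le hK.bddBelow h', le_csSup hK.bddAbove h'⟩
        have e1 : η t = 0 := by
          by_contra h0; exact ht' (Or.inl (subset_tsupport _ h0))
        have e2 : ψ t = 0 := by
          by_contra h0; exact ht' (Or.inr (subset_tsupport _ h0))
        simp [e1, e2]) (by
        rw [integral_sub hηi (hψi.const_mul I), integral_const_mul, hψ1]; simp [I])
    have h5 := h φ h1 h2 h3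
    rw [h4] at h5
    have e1 : ∫ t in Ioo 0 T, (η t - I * ψ t) * v t
        = (∫ t in Ioo 0 T, η t * v t) - I * c := by
      rw [hc, ← integral_const_mul, ← integral_sub (hmul η hη.continuous hηc)
        ((hmul ψ hψd.continuous hψc).const_mul I)]
      congr 1; ext t; ring
    have e2 : ∫ t, η t • (v t - c) = ∫ t in Ioo 0 T, η t * (v t - c) := by
      refine (setIntegral_eq_integral_of_forall_compl_eq_zero fun t ht => ?_).symm
      have : η t = 0 := by
        by_contra h0
        exact ht (hηs (subset_tsupport _ h0))
      simp [this]
    have e3 : ∫ t in Ioo 0 T, η t * (v t - c) = (∫ t in Ioo 0 T, η t * v t) - I * c := by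
      simp only [mul_sub]
      rw [integral_sub (hmul η hη.continuous hηc) (hηi.mul_const c), integral_mul_const]
    rw [e2, e3, ← e1]; exact h5
  rw [ae_restrict_iff' measurableSet_Ioo]
  filter_upwards [key] with t ht h'
  linarith [ht h']

/-- A function with an integrable weak derivative is a.e. a primitive of it. -/
theorem ae_eq_primitive {T : ℝ} (hT : 0 < T) {w w' : ℝ → ℝ} (hw : IntegrableOn w (Ioo 0 T))
    (hw' : IntegrableOn w' (Ioo 0 T))
    (h : ∀ φ : ℝ → ℝ, ContDiff ℝ ∞ φ → HasCompactSupport φ → tsupport φ ⊆ Ioo 0 T →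
      ∫ t in Ioo 0 T, deriv φ t * w t = -∫ t in Ioo 0 T, φ t * w' t) :
    ∃ c : ℝ, ∀ᵐ t ∂(volume.restrict (Ioo 0 T)), w t = c + ∫ s in (0 : ℝ)..t, w' s := by
  have hii : IntervalIntegrable w' volume 0 T := by
    rw [intervalIntegrable_iff_integrableOn_Ioo_of_le hT.le]; exact hw'
  let z : ℝ → ℝ := fun t => ∫ s in (0 : ℝ)..t, w' s
  have hz : AbsolutelyContinuousOnInterval z 0 T :=
    hii.absolutelyContinuousOnInterval_intervalIntegral (by simp)
  have hzd : ∀ᵐ t, t ∈ uIcc 0 T → deriv z t = w' t := by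
    filter_upwards [hii.ae_hasDerivAt_integral] with t ht h'
    exact (ht h' 0 (by simp)).deriv
  have hzc : ContinuousOn z (Icc 0 T) := by simpa [uIcc_of_le hT.le] using hz.continuousOn
  have hzi : IntegrableOn z (Ioo 0 T) := (hzc.integrableOn_Icc).mono_set Ioo_subset_Icc_self
  obtain ⟨c, hc⟩ := ae_eq_const_of_weak hT (v := fun t => w t - z t) (hw.sub hzi) (by
    intro φ h1 h2 h3
    have hφ : AbsolutelyContinuousOnInterval φ 0 T :=
      (h1.of_le (by exact_mod_cast le_top) : ContDiff ℝ 1 φ).contDiffOn.absolutelyContinuousOnInterval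
    have hbp := hφ.integral_mul_deriv_eq_deriv_mul hz
    have hφ0 : φ 0 = 0 := by
      by_contra h0; exact lt_irrefl _ (h3 (subset_tsupport _ h0)).1
    have hφT : φ T = 0 := by
      by_contra h0; exact lt_irrefl _ (h3 (subset_tsupport _ h0)).2
    have e0 : ∫ x in (0 : ℝ)..T, φ x * deriv z x = ∫ x in (0 : ℝ)..T, φ x * w' x := by
      refine intervalIntegral.integral_congr_ae ?_
      filter_upwards [hzd] with t ht h'
      rw [ht (uIoc_subset_uIcc h')]
    rw [e0, hφ0, hφT, intervalIntegral.integral_of_le hT.le,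
      intervalIntegral.integral_of_le hT.le, integral_Ioc_eq_integral_Ioo,
      integral_Ioc_eq_integral_Ioo] at hbp
    have hdc : Continuous (deriv φ) := h1.continuous_deriv (by simp)
    obtain ⟨C, hC⟩ := h2.deriv.exists_bound_of_continuous hdc
    have i1 : IntegrableOn (fun t => deriv φ t * w t) (Ioo 0 T) :=
      hw.bdd_mul hdc.aestronglyMeasurable (.of_forall hC)
    have i2 : IntegrableOn (fun t => deriv φ t * z t) (Ioo 0 T) :=
      hzi.bdd_mul hdc.aestronglyMeasurable (.of_forall hC)
    simp only [mul_sub]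
    rw [integral_sub i1 i2, h φ h1 h2 h3]
    linarith)
  refine ⟨c, ?_⟩
  filter_upwards [hc] with t ht
  have : w t = c + z t := by linarith
  exact this

theorem L2.integrable_coord {T : ℝ} {n : ℕ} (x : L2 T n) (i : Fin n) :
    IntegrableOn (fun t => x t i) (Ioo 0 T) := by
  have h : Integrable (fun t => x t) (timeMeasure T) := (Lp.memLp x).integrable (by norm_num)
  exact (EuclideanSpace.proj (𝕜 := ℝ) i).integrable_comp h

theorem H1.deriv_unique {T : ℝ} {n : ℕ} {x y z : L2 T n} (hy : IsWeakDeriv x y)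
    (hz : IsWeakDeriv x z) : y = z := by
  have key : ∀ i : Fin n, ∀ᵐ t ∂(timeMeasure T), y t i = z t i := by
    intro i
    have hyi := L2.integrable_coord y i
    have hzi := L2.integrable_coord z i
    have := isOpen_Ioo.ae_eq_zero_of_integral_contDiff_smul_eq_zero (μ := volume)
      (U := Ioo 0 T) (f := fun t => y t i - z t i) (hyi.sub hzi).locallyIntegrableOn
      (fun φ h1 h2 h3 => by
        obtain ⟨C, hC⟩ := h2.exists_bound_of_continuous h1.continuous
        have i1 : IntegrableOn (fun t => φ t * y t i) (Ioo 0 T) :=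
          hyi.bdd_mul h1.continuous.aestronglyMeasurable (.of_forall hC)
        have i2 : IntegrableOn (fun t => φ t * z t i) (Ioo 0 T) :=
          hzi.bdd_mul h1.continuous.aestronglyMeasurable (.of_forall hC)
        have e : ∫ t in Ioo 0 T, φ t • (y t i - z t i) = 0 := by
          simp only [smul_eq_mul, mul_sub]
          rw [integral_sub i1 i2]
          linarith [hy i φ h1 h2 h3, hz i φ h1 h2 h3]
        rw [← e]
        refine (setIntegral_eq_integral_of_forall_compl_eq_zero fun t ht => ?_).symm
        have : φ t = 0 := by
          by_contra h0
          exact ht (h3 (subset_tsupport _ h0))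
        simp [this])
    rw [ae_restrict_iff' measurableSet_Ioo]
    filter_upwards [this] with t ht h'
    linarith [ht h']
  refine Lp.ext ?_
  filter_upwards [ae_all_iff.2 key] with t ht
  ext i
  exact ht i

/-- Every `H¹` function has a representative that is continuous on `[0,T]`. -/
theorem H1.exists_continuous_rep {T : ℝ} {n : ℕ} (x : H1 T n) :
    ∃ y : ℝ → Vec n, ContinuousOn y (Icc 0 T) ∧ ∀ᵐ t ∂(timeMeasure T), y t = x.toL2 t := by
  rcases le_or_gt T 0 with hT | hT
  · refine ⟨fun _ => 0, continuousOn_const, ?_⟩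
    simp [timeMeasure, Ioo_eq_empty (not_lt.2 hT)]
  choose c hc using fun i => ae_eq_primitive hT (L2.integrable_coord x.toL2 i)
    (L2.integrable_coord x.deriv i) (x.isWeakDeriv i)
  refine ⟨fun t => WithLp.toLp 2 fun i => c i + ∫ s in (0 : ℝ)..t, x.deriv s i, ?_, ?_⟩
  · refine (PiLp.continuous_toLp 2 _).comp_continuousOn (continuousOn_pi.2 fun i => ?_)
    refine continuousOn_const.add ?_
    have hii : IntegrableOn (fun s => x.deriv s i) (uIcc 0 T) := by
      rw [uIcc_of_le hT.le, integrableOn_Icc_iff_integrableOn_Ioo]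
      exact L2.integrable_coord x.deriv i
    simpa [uIcc_of_le hT.le] using
      intervalIntegral.continuousOn_primitive_interval (a := (0 : ℝ)) (b := T) hii
  · filter_upwards [ae_all_iff.2 hc] with t ht
    ext i
    exact (ht i).symm

/-- The continuous representative of an `H¹` function on `[0,T]`; `x(0)` and `x(T)` are its
values. -/
noncomputable def H1.rep {T : ℝ} {n : ℕ} (x : H1 T n) : ℝ → Vec n :=
  x.exists_continuous_rep.choose

theorem H1.rep_spec {T : ℝ} {n : ℕ} (x : H1 T n) :
    ContinuousOn x.rep (Icc 0 T) ∧ ∀ᵐ t ∂(timeMeasure T), x.rep t = x.toL2 t :=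
  x.exists_continuous_rep.choose_spec

/-- The values of the continuous representative on `[0,T]` do not depend on any choice. -/
theorem H1.rep_unique {T : ℝ} (hT : 0 < T) {n : ℕ} (x : H1 T n) {y : ℝ → Vec n}
    (hy : ContinuousOn y (Icc 0 T)) (hxy : ∀ᵐ t ∂(timeMeasure T), y t = x.toL2 t) :
    EqOn y x.rep (Icc 0 T) := by
  refine Measure.eqOn_Icc_of_ae_eq volume hT.ne ?_ hy x.rep_spec.1
  rw [← restrict_Ioo_eq_restrict_Icc]
  filter_upwards [hxy, x.rep_spec.2] with t h1 h2
  rw [h1, h2]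

end FunctionSpaces

/-! ### Matrix notions -/

/-- A Z-matrix: the off-diagonal entries are non-positive. -/
def IsZMatrix {n : ℕ} (M : Matrix (Fin n) (Fin n) ℝ) : Prop :=
  ∀ i j, i ≠ j → M i j ≤ 0

def IsColumnAdequate {n : ℕ} (M : Matrix (Fin n) (Fin n) ℝ) : Prop :=
  ∀ z : Fin n → ℝ, (∀ i, z i * (M.mulVec z) i ≤ 0) → M.mulVec z = 0

def IsRowAdequate {n : ℕ} (M : Matrix (Fin n) (Fin n) ℝ) : Prop :=
  IsColumnAdequate M.transpose

def IsAdequate {n : ℕ} (M : Matrix (Fin n) (Fin n) ℝ) : Prop :=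
  IsColumnAdequate M ∧ IsRowAdequate M

/-- The matrix norm induced by the `ℓ¹` norm: the maximal absolute column sum. -/
noncomputable def matrixNormOne {ι : Type*} [Fintype ι] (M : Matrix ι ι ℝ) : ℝ :=
  ⨆ j, ∑ i, |M i j|

/-- The principal submatrix `M_{J,J}`. -/
def principalSubmatrix {n : ℕ} (M : Matrix (Fin n) (Fin n) ℝ) (J : Finset (Fin n)) :
    Matrix J J ℝ :=
  M.submatrix Subtype.val Subtype.val

open Classical in
/-- The nonempty index sets `J` with `M_{J,J}` nonsingular. -/
noncomputable def nonsingularSets {n : ℕ} (M : Matrix (Fin n) (Fin n) ℝ) :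
    Finset (Finset (Fin n)) :=
  Finset.univ.filter fun J => J.Nonempty ∧ IsUnit (principalSubmatrix M J).det

open Classical in
/-- `β = max ‖(M_{J,J})⁻¹‖₁` over the nonempty `J` with `M_{J,J}` nonsingular, and `β = 1` if
there is no such `J`. -/
noncomputable def beta {n : ℕ} (M : Matrix (Fin n) (Fin n) ℝ) : ℝ :=
  if h : (nonsingularSets M).Nonempty then
    (nonsingularSets M).sup' h fun J => matrixNormOne (principalSubmatrix M J)⁻¹
  else 1

/-- The pseudoinverse `Dᵀ (D Dᵀ)⁻¹` of a matrix `D` of full row rank. -/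
noncomputable def pinv {l m : ℕ} (D : Matrix (Fin l) (Fin m) ℝ) : Matrix (Fin m) (Fin l) ℝ :=
  D.transpose * (D * D.transpose)⁻¹

/-- The matrix `[N, G N, G² N, …, Gⁿ⁻¹ N]`; its columns are indexed by (block, column). -/
def krylovMatrix {n r : ℕ} (G : Matrix (Fin n) (Fin n) ℝ) (N : Matrix (Fin n) (Fin r) ℝ) :
    Matrix (Fin n) (Fin n × Fin r) ℝ :=
  Matrix.of fun i kj => (G ^ (kj.1 : ℕ) * N) i kj.2

/-! ### The optimal control problem -/

/-- The data of the optimal control problem with terminal stochastic linear complementarity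
constraints, over a measure space `(Ω, P)`, with the standing requirements on them. The random
variable is `ξ`, its support set `Ξ` is `range ξ`, and `F`, `g`, `M`, `q` are functions of a point
of `Ξ`. The dimension of the space containing `K` is `k`. -/
structure Problem {Ω : Type*} [MeasurableSpace Ω] (P : Measure Ω) (d n m l k : ℕ) where
  T : ℝ
  T_pos : 0 < T
  A : Matrix (Fin n) (Fin n) ℝ
  B : Matrix (Fin n) (Fin m) ℝ
  C : Matrix (Fin l) (Fin n) ℝ
  D : Matrix (Fin l) (Fin m) ℝ
  x₀ : Vec n
  f : L2 T l
  xd : L2 T n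
  ud : L2 T m
  δ : ℝ
  δ_pos : 0 < δ
  K : Set (Vec k)
  K_nonempty : K.Nonempty
  K_closed : IsClosed K
  K_convex : Convex ℝ K
  ξ : Ω → Vec d
  measurable_ξ : Measurable ξ
  F : Vec n → range ξ → ℝ
  g : Vec n → range ξ → Vec k
  M : range ξ → Matrix (Fin n) (Fin n) ℝ
  q : range ξ → Vec n
  measurable_F : ∀ z, Measurable (F z)
  measurable_g : ∀ z, Measurable (g z)
  measurable_M : ∀ i j, Measurable fun s => M s i j
  measurable_q : Measurable q
  contDiff_F : ∀ᵐ ω ∂P, ContDiff ℝ 1 fun z => F z (rangeFactorization ξ ω)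
  contDiff_g : ∀ᵐ ω ∂P, ContDiff ℝ 1 fun z => g z (rangeFactorization ξ ω)

namespace Problem

variable {Ω : Type*} [MeasurableSpace Ω] {P : Measure Ω} {d n m l k : ℕ}

/-- The value of the random variable `ξ` as a point of its support set. -/
def sample (p : Problem P d n m l k) (ω : Ω) : range p.ξ := rangeFactorization p.ξ ω

/-- `E[M(ξ)]`. -/
noncomputable def meanM (p : Problem P d n m l k) : Matrix (Fin n) (Fin n) ℝ :=
  Matrix.of fun i j => ∫ ω, p.M (p.sample ω) i j ∂P

/-- `E[q(ξ)]`. -/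
noncomputable def meanQ (p : Problem P d n m l k) : Vec n := ∫ ω, p.q (p.sample ω) ∂P

/-- `z ↦ E[M(ξ) z + q(ξ)]`. -/
noncomputable def lcpMap (p : Problem P d n m l k) (z : Vec n) : Vec n :=
  ∫ ω, Matrix.toEuclideanLin (p.M (p.sample ω)) z + p.q (p.sample ω) ∂P

/-- `z ↦ E[F(z, ξ)]`. -/
noncomputable def meanF (p : Problem P d n m l k) (z : Vec n) : ℝ :=
  ∫ ω, p.F z (p.sample ω) ∂P

/-- `z ↦ E[g(z, ξ)]`. -/
noncomputable def meanG (p : Problem P d n m l k) (z : Vec n) : Vec k :=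
  ∫ ω, p.g z (p.sample ω) ∂P

/-- The growth conditions on the random data, with the bounds `κ₁, …, κ₄`. The norm of `M(ξ)` is
the one induced by the Euclidean norm. -/
structure GrowthBounds (p : Problem P d n m l k) (κ₁ κ₂ κ₃ κ₄ : range p.ξ → ℝ) : Prop where
  measurable₁ : Measurable κ₁
  measurable₂ : Measurable κ₂
  measurable₃ : Measurable κ₃
  measurable₄ : Measurable κ₄
  nonneg₁ : ∀ s, 0 ≤ κ₁ s
  nonneg₂ : ∀ s, 0 ≤ κ₂ s
  nonneg₃ : ∀ s, 0 ≤ κ₃ s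
  nonneg₄ : ∀ s, 0 ≤ κ₄ s
  integrable₁ : Integrable (fun ω => κ₁ (p.sample ω)) P
  integrable₂ : Integrable (fun ω => κ₂ (p.sample ω)) P
  integrable₃ : Integrable (fun ω => κ₃ (p.sample ω)) P
  integrable₄ : Integrable (fun ω => κ₄ (p.sample ω)) P
  lipschitz_F : ∀ z₁ z₂ : Vec n, ∀ᵐ ω ∂P,
    |p.F z₁ (p.sample ω) - p.F z₂ (p.sample ω)| ≤ κ₁ (p.sample ω) * ‖z₁ - z₂‖
  bound_g : ∀ z : Vec n, ∀ᵐ ω ∂P, ‖p.g z (p.sample ω)‖ ≤ κ₂ (p.sample ω) * ‖z‖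
  bound_M : ∀ s, ‖Matrix.toEuclideanCLM (𝕜 := ℝ) (p.M s)‖ ≤ κ₃ s
  bound_q : ∀ s, ‖p.q s‖ ≤ κ₄ s

/-- `l < m`, `D` has full row rank, and, for a matrix `Y` of full column rank `m - l` with
`D Y = 0`, the matrix `[BY, (A - B D† C)BY, …, (A - B D† C)ⁿ⁻¹ BY]` has full row rank. -/
def Controllable (p : Problem P d n m l k) : Prop :=
  l < m ∧ p.D.rank = l ∧
    ∃ Y : Matrix (Fin m) (Fin (m - l)) ℝ, Y.rank = m - l ∧ p.D * Y = 0 ∧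
      (krylovMatrix (p.A - p.B * pinv p.D * p.C) (p.B * Y)).rank = n

/-- `(x,u) ∈ H¹(0,T)ⁿ × L²(0,T)ᵐ` satisfies the constraints of the problem. -/
structure IsFeasible (p : Problem P d n m l k) (x : H1 p.T n) (u : L2 p.T m) : Prop where
  dynamics : ∀ᵐ t ∂(timeMeasure p.T),
    x.deriv t = Matrix.toEuclideanLin p.A (x.toL2 t) + Matrix.toEuclideanLin p.B (u t)
  path : ∀ᵐ t ∂(timeMeasure p.T), ∀ i : Fin l,
    (Matrix.toEuclideanLin p.C (x.toL2 t) + Matrix.toEuclideanLin p.D (u t) - p.f t) i ≤ 0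
  initial : x.rep 0 = p.x₀
  terminal_nonneg : ∀ i, 0 ≤ x.rep p.T i
  terminal_lcp_nonneg : ∀ i, 0 ≤ p.lcpMap (x.rep p.T) i
  terminal_orthogonal : inner ℝ (x.rep p.T) (p.lcpMap (x.rep p.T)) = 0
  terminal_mem : p.meanG (x.rep p.T) ∈ p.K

/-- The objective `Φ(x,u) = E[F(x(T),ξ)] + ½‖x - x_d‖² + (δ/2)‖u - u_d‖²`. -/
noncomputable def objective (p : Problem P d n m l k) (x : H1 p.T n) (u : L2 p.T m) : ℝ :=
  p.meanF (x.rep p.T) + 1 / 2 * ‖x.toL2 - p.xd‖ ^ 2 + p.δ / 2 * ‖u - p.ud‖ ^ 2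

/-- `(x,u)` is a global minimizer of the objective among the feasible pairs. -/
def IsOptimal (p : Problem P d n m l k) (x : H1 p.T n) (u : L2 p.T m) : Prop :=
  p.IsFeasible x u ∧ ∀ (y : H1 p.T n) (v : L2 p.T m), p.IsFeasible y v →
    p.objective x u ≤ p.objective y v

end Problem

end TerminalSLCC

/-! The problem splits at the terminal state z = x(T). The terminal constraints concern z alone and
cut out a closed, possibly nonconvex set. For fixed z, the dynamics and the path constraint cut out
a closed set of pairs (x,u), and this set depends on z in a jointly convex way.

Feasibility has two halves. By linearity of expectation the complementarity problem is the
deterministic one with data E[M], E[q]. It has a solution z whose support J makes M_{J,J}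
nonsingular (`exists_lcpSolution_nonsingular`). Then z_J = -(M_{J,J})⁻¹ q_J, so ‖z‖₁ ≤ β‖q‖₁, and
linear growth of g puts E[g(z,ξ)] in the ball contained in K (`nonempty_terminalSet`). For a
Z-matrix, z is a feasible vector of least coordinate sum. For an adequate matrix, z comes from a
minimizer of zᵀ(Mz+q): column adequacy yields the minimizer and shrinks its support, while row
adequacy turns the Farkas multipliers into complementarity. The other half is that every z is
reachable (`exists_trajectory`): the feedback u = D†(f - Cx) + Yv gives Cx + Du = f and leaves a
linear system controlled by v, to which the Kalman rank condition applies.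

For optimality, the control and tracking costs are half a squared distance in a Hilbert space. Its
minimum over pairs reaching z is attained by projection. The distance is a finite convex function of
z, hence continuous, and it controls ‖z‖. With E[F(z,ξ)] continuous and bounded below, minimizing
over z becomes a compactness argument in ℝⁿ (`exists_min_add_sq_dist`). -/

namespace TerminalSLCC

/-! ### Farkas' lemma, the bound by β, and regularized minimization for linear complementarity
problems. -/

section LinearComplementarity

open Matrix Filter Topology

/-- **Farkas' lemma** for finitely many linear functionals (Bartl's proof by induction). -/
theorem farkas {V ι : Type*} [AddCommGroup V] [Module ℝ V] (s : Finset ι)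
    (a : ι → V →ₗ[ℝ] ℝ) (b : V →ₗ[ℝ] ℝ) (h : ∀ x, (∀ i ∈ s, 0 ≤ a i x) → 0 ≤ b x) :
    ∃ c : ι → ℝ, (∀ i, 0 ≤ c i) ∧ b = ∑ i ∈ s, c i • a i := by
  classical
  induction s using Finset.induction_on generalizing a b with
  | empty =>
    refine ⟨0, fun _ => le_rfl, LinearMap.ext fun x => ?_⟩
    have h1 := h x (by simp)
    have h2 := h (-x) (by simp)
    simp only [map_neg] at h2
    simp only [Finset.sum_empty, LinearMap.zero_apply]
    linarith
  | insert j s hj ih =>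
    by_cases hs : ∀ x, (∀ i ∈ s, 0 ≤ a i x) → 0 ≤ b x
    · obtain ⟨c, hc, hb⟩ := ih a b hs
      refine ⟨Function.update c j 0, fun i => ?_, ?_⟩
      · by_cases hi : i = j
        · subst hi; simp
        · simp [hi, hc i]
      · rw [Finset.sum_insert hj, Function.update_self, zero_smul, zero_add, hb]
        refine Finset.sum_congr rfl fun i hi => ?_
        rw [Function.update_of_ne (ne_of_mem_of_not_mem hi hj)]
    · push Not at hs
      obtain ⟨y, hy, hby⟩ := hs
      have hjy : a j y < 0 := by
        by_contra hn
        refine absurd (h y fun i hi => ?_) (not_le.2 hby)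
        rcases Finset.mem_insert.1 hi with rfl | hi
        · exact not_lt.1 hn
        · exact hy i hi
      -- Here `a j y < 0`. The new functionals are the old ones composed with the projection onto
      -- ker `a j` along `y`, where the constraint `j` holds trivially, so the induction hypothesis
      -- applies to them.
      obtain ⟨c, hc, hb⟩ := ih (fun i => a i - (a i y / a j y) • a j) (b - (b y / a j y) • a j)
        (by
          intro x hx
          have h1 := h (x - (a j x / a j y) • y) (by
            intro i hi
            rcases Finset.mem_insert.1 hi with rfl | hi
            · simp [hjy.ne]
            · have := hx i hi
              simp only [LinearMap.sub_apply, LinearMap.smul_apply, smul_eq_mul] at this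
              simp only [map_sub, map_smul, smul_eq_mul]
              convert this using 2
              ring)
          simp only [map_sub, map_smul, smul_eq_mul] at h1
          simp only [LinearMap.sub_apply, LinearMap.smul_apply, smul_eq_mul]
          convert h1 using 2
          ring)
      -- The coefficient of `a j` is what remains after undoing the projection. It is nonnegative
      -- since `b y < 0`, `c i * a i y ≥ 0` and `a j y < 0`.
      refine ⟨Function.update c j ((b y - ∑ i ∈ s, c i * a i y) / a j y), fun i => ?_, ?_⟩
      · by_cases hi : i = j
        · subst hi
          rw [Function.update_self]
          refine div_nonneg_of_nonpos ?_ hjy.le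
          have := Finset.sum_nonneg fun i hi => mul_nonneg (hc i) (hy i hi)
          linarith
        · simp [hi, hc i]
      · rw [Finset.sum_insert hj, Function.update_self]
        have e : ∑ i ∈ s, Function.update c j ((b y - ∑ i ∈ s, c i * a i y) / a j y) i • a i
            = ∑ i ∈ s, c i • a i := Finset.sum_congr rfl fun i hi => by
          rw [Function.update_of_ne (ne_of_mem_of_not_mem hi hj)]
        rw [e]
        ext x
        have hx := LinearMap.congr_fun hb x
        simp only [LinearMap.sub_apply, LinearMap.smul_apply, smul_eq_mul, LinearMap.sum_apply,
          LinearMap.add_apply, mul_sub, Finset.sum_sub_distrib] at hx ⊢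
        have e2 : ∑ i ∈ s, c i * (a i y / a j y * a j x)
            = (∑ i ∈ s, c i * a i y) / a j y * a j x := by
          rw [Finset.sum_div, Finset.sum_mul]
          exact Finset.sum_congr rfl fun i _ => by ring
        rw [e2] at hx
        rw [sub_div, sub_mul]
        linarith

variable {n : ℕ}

/-- `z` solves the linear complementarity problem `0 ≤ z ⟂ M z + q ≥ 0`. -/
def IsLCPSolution (M : Matrix (Fin n) (Fin n) ℝ) (q z : Fin n → ℝ) : Prop :=
  ∀ i, 0 ≤ z i ∧ 0 ≤ (M *ᵥ z + q) i ∧ z i * (M *ᵥ z + q) i = 0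

/-- The index set of the nonzero entries of a vector. -/
noncomputable def supp (z : Fin n → ℝ) : Finset (Fin n) :=
  Finset.univ.filter fun i => z i ≠ 0

theorem mem_supp {z : Fin n → ℝ} {i : Fin n} : i ∈ supp z ↔ z i ≠ 0 := by
  simp [supp]

theorem mulVec_apply_eq_sum_principal (M : Matrix (Fin n) (Fin n) ℝ) {J : Finset (Fin n)}
    {v : Fin n → ℝ} (hv : ∀ i, i ∉ J → v i = 0) (i : J) :
    (M *ᵥ v) i = (principalSubmatrix M J *ᵥ fun j => v j) i := by
  simp only [mulVec, dotProduct, principalSubmatrix, submatrix_apply]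
  rw [Finset.sum_coe_sort J (fun j => M i j * v j)]
  refine (Finset.sum_subset (Finset.subset_univ J) fun j _ hj => ?_).symm
  simp [hv j hj]

/-- A kernel vector of the submatrix, extended by zero. Nothing is known about `M *ᵥ v` outside `J`;
there the sign pattern or adequacy has to step in. -/
theorem exists_kernel_of_singular (M : Matrix (Fin n) (Fin n) ℝ) {J : Finset (Fin n)}
    (h : ¬ IsUnit (principalSubmatrix M J).det) :
    ∃ v : Fin n → ℝ, v ≠ 0 ∧ (∀ i, i ∉ J → v i = 0) ∧ ∀ i ∈ J, (M *ᵥ v) i = 0 := by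
  classical
  obtain ⟨w, hw, hMw⟩ := exists_mulVec_eq_zero_iff.2 (by simpa using h)
  have hv : ∀ i, i ∉ J → (fun i => if h : i ∈ J then w ⟨i, h⟩ else 0) i = 0 := fun i hi => by
    simp [hi]
  refine ⟨fun i => if h : i ∈ J then w ⟨i, h⟩ else 0, fun h0 => hw ?_, hv, fun i hi => ?_⟩
  · ext ⟨j, hj⟩
    have := congr_fun h0 j
    simpa [hj] using this
  · rw [mulVec_apply_eq_sum_principal M hv ⟨i, hi⟩]
    have : (fun j : J => (fun i => if h : i ∈ J then w ⟨i, h⟩ else 0) (j : Fin n)) = w := by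
      ext ⟨j, hj⟩; simp [hj]
    rw [this, hMw]; rfl

theorem matrixNormOne_nonneg {ι : Type*} [Fintype ι] (N : Matrix ι ι ℝ) : 0 ≤ matrixNormOne N :=
  Real.iSup_nonneg fun _ => Finset.sum_nonneg fun _ _ => abs_nonneg _

theorem sum_abs_mulVec_le {ι : Type*} [Fintype ι] (N : Matrix ι ι ℝ) (v : ι → ℝ) :
    ∑ i, |(N *ᵥ v) i| ≤ matrixNormOne N * ∑ i, |v i| := by
  calc ∑ i, |(N *ᵥ v) i| ≤ ∑ i, ∑ j, |N i j| * |v j| := by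
        refine Finset.sum_le_sum fun i _ => ?_
        refine (Finset.abs_sum_le_sum_abs _ _).trans_eq ?_
        simp [abs_mul]
    _ = ∑ j, (∑ i, |N i j|) * |v j| := by
        rw [Finset.sum_comm]; simp [Finset.sum_mul]
    _ ≤ ∑ j, matrixNormOne N * |v j| := by
        refine Finset.sum_le_sum fun j _ => mul_le_mul_of_nonneg_right ?_ (abs_nonneg _)
        exact le_ciSup (f := fun j => ∑ i, |N i j|) (Set.finite_range _).bddAbove j
    _ = _ := by rw [Finset.mul_sum]

theorem beta_nonneg (M : Matrix (Fin n) (Fin n) ℝ) : 0 ≤ beta M := by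
  unfold beta
  split_ifs with h
  · obtain ⟨J, hJ⟩ := h
    exact (matrixNormOne_nonneg _).trans
      (Finset.le_sup' (fun J => matrixNormOne (principalSubmatrix M J)⁻¹) hJ)
  · exact zero_le_one

/-- On the support J of z complementarity forces (Mz + q)_J = 0, that is M_{J,J} z_J = -q_J, and the
inverse is among those that define β. For empty support z = 0, and only β ≥ 0 is needed. -/
theorem IsLCPSolution.sum_abs_le {M : Matrix (Fin n) (Fin n) ℝ} {q z : Fin n → ℝ}
    (hz : IsLCPSolution M q z) (h : IsUnit (principalSubmatrix M (supp z)).det) :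
    ∑ i, |z i| ≤ beta M * ∑ i, |q i| := by
  classical
  rcases (supp z).eq_empty_or_nonempty with h0 | h0
  · have : ∀ i, z i = 0 := fun i => by
      by_contra hi
      have := mem_supp.2 hi
      simp [h0] at this
    simp only [this, abs_zero, Finset.sum_const_zero]
    exact mul_nonneg (beta_nonneg M) (Finset.sum_nonneg fun _ _ => abs_nonneg _)
  have hmem : supp z ∈ nonsingularSets M :=
    Finset.mem_filter.2 ⟨Finset.mem_univ _, h0, by convert h⟩
  have hbeta : matrixNormOne (principalSubmatrix M (supp z))⁻¹ ≤ beta M := by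
    unfold beta
    rw [dif_pos ⟨_, hmem⟩]
    exact Finset.le_sup' (fun J => matrixNormOne (principalSubmatrix M J)⁻¹) hmem
  have hzs : ∀ i, i ∉ supp z → z i = 0 := fun i hi => by simpa [mem_supp] using hi
  have e : principalSubmatrix M (supp z) *ᵥ (fun j => z j) = fun j : supp z => -q j := by
    ext j
    rw [← mulVec_apply_eq_sum_principal M hzs j]
    have h1 := (hz j).2.2
    have h2 := mem_supp.1 j.2
    have h3 := (mul_eq_zero.1 h1).resolve_left h2
    simp only [Pi.add_apply] at h3
    linarith
  have e2 : (fun j : supp z => z j) = (principalSubmatrix M (supp z))⁻¹ *ᵥ fun j : supp z => -q j := by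
    rw [← e, mulVec_mulVec, nonsing_inv_mul _ h, one_mulVec]
  have e3 : ∑ i, |z i| = ∑ j : supp z, |z j| := by
    rw [Finset.sum_coe_sort (supp z) (fun j => |z j|)]
    refine (Finset.sum_subset (Finset.subset_univ _) fun j _ hj => ?_).symm
    simp [hzs j hj]
  have e4 : ∑ j : supp z, |-q j| ≤ ∑ i, |q i| := by
    simp only [abs_neg]
    rw [Finset.sum_coe_sort (supp z) (fun j => |q j|)]
    exact Finset.sum_le_sum_of_subset_of_nonneg (Finset.subset_univ _) fun _ _ _ => abs_nonneg _
  rw [e3]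
  have := sum_abs_mulVec_le (principalSubmatrix M (supp z))⁻¹ fun j : supp z => -q j
  rw [← e2] at this
  exact this.trans (mul_le_mul hbeta e4 (Finset.sum_nonneg fun _ _ => abs_nonneg _) (beta_nonneg M))

/-- The vectors `z ≥ 0` with `M z + q ≥ 0`. -/
def lcpFeasible (M : Matrix (Fin n) (Fin n) ℝ) (q : Fin n → ℝ) : Set (Fin n → ℝ) :=
  {z | ∀ i, 0 ≤ z i ∧ 0 ≤ (M *ᵥ z + q) i}

theorem continuous_lcp_apply (M : Matrix (Fin n) (Fin n) ℝ) (q : Fin n → ℝ) (i : Fin n) :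
    Continuous fun z : Fin n → ℝ => (M *ᵥ z + q) i :=
  ((continuous_apply i).comp (Continuous.matrix_mulVec continuous_const continuous_id)).add
    continuous_const

theorem isClosed_lcpFeasible (M : Matrix (Fin n) (Fin n) ℝ) (q : Fin n → ℝ) :
    IsClosed (lcpFeasible M q) := by
  simp only [lcpFeasible, Set.ofPred_forall, Set.ofPred_and]
  exact isClosed_iInter fun i => (isClosed_le continuous_const (continuous_apply i)).inter
    (isClosed_le continuous_const (continuous_lcp_apply M q i))

/-- A continuous function that is nonnegative on the feasible set, plus a positive multiple of the
coordinate sum, attains its minimum. -/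
theorem exists_min_add_sum (M : Matrix (Fin n) (Fin n) ℝ) (q : Fin n → ℝ)
    (hne : (lcpFeasible M q).Nonempty) {f : (Fin n → ℝ) → ℝ} (hf : Continuous f)
    (hf0 : ∀ z ∈ lcpFeasible M q, 0 ≤ f z) {ε : ℝ} (hε : 0 < ε) :
    ∃ z ∈ lcpFeasible M q, ∀ y ∈ lcpFeasible M q, f z + ε * ∑ i, z i ≤ f y + ε * ∑ i, y i := by
  obtain ⟨y, hy⟩ := hne
  set c := f y + ε * ∑ i, y i with hc
  have hcont : Continuous fun z : Fin n → ℝ => f z + ε * ∑ i, z i := by fun_prop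
  have hcpt : IsCompact (lcpFeasible M q ∩ Set.Icc 0 fun _ => c / ε) :=
    isCompact_Icc.inter_left (isClosed_lcpFeasible M q)
  -- Since f ≥ 0 and z ≥ 0, the sublevel set through the feasible point `y` lies in a box, so the
  -- minimum is taken over a compact set.
  have hin : ∀ z ∈ lcpFeasible M q, f z + ε * ∑ i, z i ≤ c → z ∈ Set.Icc 0 fun _ => c / ε := by
    intro z hz hzc
    refine ⟨fun i => (hz i).1, fun i => ?_⟩
    have h1 := hf0 z hz
    have h2 : z i ≤ ∑ i, z i :=
      Finset.single_le_sum (f := z) (fun j _ => (hz j).1) (Finset.mem_univ i)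
    show z i ≤ c / ε
    rw [le_div_iff₀ hε]
    nlinarith
  obtain ⟨z, ⟨hz, -⟩, hmin⟩ := hcpt.exists_isMinOn ⟨y, hy, hin y hy le_rfl⟩ hcont.continuousOn
  refine ⟨z, hz, fun x hx => ?_⟩
  by_cases hxc : f x + ε * ∑ i, x i ≤ c
  · exact hmin ⟨hx, hin x hx hxc⟩
  · exact (hmin ⟨hy, hin y hy le_rfl⟩).trans (not_le.1 hxc).le

end LinearComplementarity

/-! ### Solutions with nonsingular support, for Z-matrices and for adequate matrices. -/

section LinearComplementarityExistence

open Matrix Filter Topology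

variable {n : ℕ}

/-- Moving a nonnegative vector against a direction with a positive entry until an entry
vanishes. -/
theorem exists_ratio_step {z v : Fin n → ℝ} (hz : ∀ i, 0 ≤ z i) (hv : ∀ i, z i = 0 → v i = 0)
    (hpos : ∃ i, 0 < v i) :
    ∃ t, 0 < t ∧ (∀ i, t * v i ≤ z i) ∧ supp (z - t • v) ⊂ supp z := by
  classical
  obtain ⟨i₀, hi₀⟩ := hpos
  -- Ratio test: the least z i / v i over positive v i is the longest step that keeps z - t v ≥ 0,
  -- and the minimizing index leaves the support.
  obtain ⟨k, hk, hmin⟩ := Finset.exists_min_image (Finset.univ.filter fun i => 0 < v i)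
    (fun i => z i / v i) ⟨i₀, by simpa using hi₀⟩
  have hvk : 0 < v k := by simpa using hk
  have hzk : 0 < z k := lt_of_le_of_ne (hz k) fun h => hvk.ne' (hv k h.symm)
  have ht : 0 < z k / v k := div_pos hzk hvk
  refine ⟨z k / v k, ht, fun i => ?_, (Finset.ssubset_iff_of_subset fun i hi => ?_).2
    ⟨k, mem_supp.2 hzk.ne', fun h => mem_supp.1 h ?_⟩⟩
  · by_cases hi : 0 < v i
    · exact (le_div_iff₀ hi).1 (hmin i (by simpa using hi))
    · exact (mul_nonpos_of_nonneg_of_nonpos ht.le (not_lt.1 hi)).trans (hz i)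
  · rw [mem_supp] at hi ⊢
    intro h
    exact hi (by simp [h, hv i h])
  · simp [hvk.ne']

theorem exists_pos_or_neg_pos {v : Fin n → ℝ} (hv : v ≠ 0) :
    (∃ i, 0 < v i) ∨ ∃ i, 0 < (-v) i := by
  obtain ⟨i, hi⟩ := Function.ne_iff.1 hv
  rcases lt_or_gt_of_ne hi with h | h
  · exact Or.inr ⟨i, by simpa using h⟩
  · exact Or.inl ⟨i, h⟩

theorem exists_kernel_of_singular_pos (M : Matrix (Fin n) (Fin n) ℝ) {J : Finset (Fin n)}
    (h : ¬ IsUnit (principalSubmatrix M J).det) :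
    ∃ v : Fin n → ℝ, (∃ i, 0 < v i) ∧ (∀ i, i ∉ J → v i = 0) ∧ ∀ i ∈ J, (M *ᵥ v) i = 0 := by
  obtain ⟨v, hv, h1, h2⟩ := exists_kernel_of_singular M h
  rcases exists_pos_or_neg_pos hv with h0 | h0
  · exact ⟨v, h0, h1, h2⟩
  · exact ⟨-v, h0, fun i hi => by simp [h1 i hi], fun i hi => by simp [mulVec_neg, h2 i hi]⟩

/-- Row i meets the other coordinates with nonpositive weights. This makes the feasible set stable
under componentwise minima. -/
theorem IsZMatrix.mulVec_le {M : Matrix (Fin n) (Fin n) ℝ} (hM : IsZMatrix M) {x y : Fin n → ℝ}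
    (hxy : ∀ j, y j ≤ x j) {i : Fin n} (hi : y i = x i) : (M *ᵥ x) i ≤ (M *ᵥ y) i := by
  simp only [mulVec, dotProduct]
  refine Finset.sum_le_sum fun j _ => ?_
  by_cases hj : i = j
  · subst hj; rw [hi]
  · exact mul_le_mul_of_nonpos_left (hxy j) (hM i j hj)

/-- A feasible vector of least coordinate sum has no other feasible vector below it. If
complementarity failed at i, z i could be lowered. If the support were singular, a kernel direction
followed by a componentwise minimum would give a smaller feasible vector. -/
theorem IsZMatrix.exists_solution {M : Matrix (Fin n) (Fin n) ℝ} (hM : IsZMatrix M)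
    {q : Fin n → ℝ} (hne : (lcpFeasible M q).Nonempty) :
    ∃ z, IsLCPSolution M q z ∧ IsUnit (principalSubmatrix M (supp z)).det := by
  obtain ⟨z, hz, hmin⟩ := exists_min_add_sum M q hne (f := fun _ => 0) continuous_const
    (fun _ _ => le_rfl) one_pos
  have hmin' : ∀ y ∈ lcpFeasible M q, (∀ i, y i ≤ z i) → y = z := by
    intro y hy hyz
    have h1 := hmin y hy
    simp only [zero_add, one_mul] at h1
    have h2 := (Finset.sum_eq_sum_iff_of_le fun i _ => hyz i).1
      (le_antisymm (Finset.sum_le_sum fun i _ => hyz i) h1)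
    exact funext fun i => h2 i (Finset.mem_univ i)
  have hsol : IsLCPSolution M q z := by
    intro i
    refine ⟨(hz i).1, (hz i).2, ?_⟩
    by_contra hne
    have hzi : 0 < z i := lt_of_le_of_ne (hz i).1 fun h => hne (by rw [← h, zero_mul])
    have hwi : 0 < (M *ᵥ z + q) i := lt_of_le_of_ne (hz i).2 fun h => hne (by rw [← h, mul_zero])
    -- Small enough to keep both z i and row i nonnegative; the + 1 avoids a zero denominator. The
    -- other rows can only grow.
    set t := min (z i) ((M *ᵥ z + q) i / (|M i i| + 1)) with ht
    have hd : 0 < |M i i| + 1 := by positivity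
    have ht0 : 0 < t := lt_min hzi (div_pos hwi hd)
    have htz : t ≤ z i := min_le_left _ _
    have htw : t * (|M i i| + 1) ≤ (M *ᵥ z + q) i := (le_div_iff₀ hd).1 (min_le_right _ _)
    have hy := hmin' (z - t • Pi.single i 1) (by
      intro j
      have e : (M *ᵥ (z - t • Pi.single i 1) + q) j = (M *ᵥ z + q) j - t * M j i := by
        simp [mulVec_sub, mulVec_smul]; ring
      rw [e]
      by_cases hj : j = i
      · subst hj
        refine ⟨by simpa using htz, ?_⟩
        nlinarith [le_abs_self (M j j)]
      · refine ⟨by simpa [hj] using (hz j).1, ?_⟩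
        nlinarith [(hz j).2, hM j i hj]) (by
      intro j
      by_cases hj : j = i
      · subst hj; simpa using ht0.le
      · simp [hj])
    have := congr_fun hy i
    simp [ht0.ne'] at this
  refine ⟨z, hsol, ?_⟩
  by_contra hsing
  obtain ⟨v, ⟨k, hk⟩, hv, hMv⟩ := exists_kernel_of_singular_pos M hsing
  have hv' : ∀ i, z i = 0 → v i = 0 := fun i hi => hv i fun h => mem_supp.1 h hi
  obtain ⟨t, ht, htv, -⟩ := exists_ratio_step (fun i => (hz i).1) hv' ⟨k, hk⟩
  -- Row i is compared with whichever of z and z - t v gives the minimum at i. If it is not z, then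
  -- i lies in the support, where M v vanishes, so both comparisons end at (Mz + q) i ≥ 0.
  have hy := hmin' (z ⊓ (z - t • v)) (by
    intro i
    refine ⟨le_inf (hz i).1 (by simpa using htv i), ?_⟩
    by_cases hi : (z ⊓ (z - t • v)) i = z i
    · have := hM.mulVec_le (x := z) (y := z ⊓ (z - t • v)) (fun j => inf_le_left) hi
      have := (hz i).2
      simp only [Pi.add_apply] at *
      linarith
    · have hi' : (z ⊓ (z - t • v)) i = (z - t • v) i := (min_choice (z i) ((z - t • v) i)).resolve_left hi
      have hzi : i ∈ supp z := by
        refine mem_supp.2 fun h => hi ?_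
        rw [hi']; simp [hv' i h]
      have := hM.mulVec_le (x := z - t • v) (y := z ⊓ (z - t • v)) (fun j => inf_le_right) hi'
      have h2 := (hz i).2
      rw [mulVec_sub, mulVec_smul] at this
      simp only [Pi.add_apply, Pi.sub_apply, Pi.smul_apply, hMv i hzi, smul_zero, sub_zero] at *
      linarith) fun i => inf_le_left
  have h1 := congr_fun hy k
  have h2 : (z ⊓ (z - t • v)) k ≤ (z - t • v) k := inf_le_right
  rw [h1] at h2
  have := mul_pos ht hk
  simp at h2
  linarith

/-- A solution with the fewest nonzero entries. -/
theorem IsColumnAdequate.exists_solution_nonsingular {M : Matrix (Fin n) (Fin n) ℝ}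
    (hM : IsColumnAdequate M) {q : Fin n → ℝ} (hne : ∃ z, IsLCPSolution M q z) :
    ∃ z, IsLCPSolution M q z ∧ IsUnit (principalSubmatrix M (supp z)).det := by
  classical
  have hex : ∃ N, ∃ z, IsLCPSolution M q z ∧ (supp z).card = N :=
    let ⟨z, hz⟩ := hne; ⟨_, z, hz, rfl⟩
  obtain ⟨z, hz, hcard⟩ := Nat.find_spec hex
  refine ⟨z, hz, ?_⟩
  by_contra hsing
  obtain ⟨v, hpos, hv, hMv⟩ := exists_kernel_of_singular_pos M hsing
  have hv' : ∀ i, z i = 0 → v i = 0 := fun i hi => hv i fun h => mem_supp.1 h hi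
  -- Each product v i * (M v) i is zero: M v vanishes on the support of z and v off it. Hence moving
  -- along v leaves Mz + q unchanged, and the ratio step gives a solution of smaller support.
  have hMv0 : M *ᵥ v = 0 := hM v fun i => by
    by_cases hi : i ∈ supp z
    · simp [hMv i hi]
    · simp [hv i hi]
  obtain ⟨t, -, htv, hlt⟩ := exists_ratio_step (fun i => (hz i).1) hv' hpos
  have e : M *ᵥ (z - t • v) = M *ᵥ z := by simp [mulVec_sub, mulVec_smul, hMv0]
  refine Nat.find_min hex (hcard ▸ Finset.card_lt_card hlt) ⟨z - t • v, fun i => ?_, rfl⟩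
  rw [e]
  refine ⟨by simpa using htv i, (hz i).2.1, ?_⟩
  rcases mul_eq_zero.1 (hz i).2.2 with h | h
  · simp [h, hv' i h]
  · rw [h, mul_zero]

/-- For a column adequate matrix, feasible vectors with bounded value of the quadratic form can
only be unbounded along a nonnegative kernel direction. -/
theorem IsColumnAdequate.exists_kernel_direction {M : Matrix (Fin n) (Fin n) ℝ}
    (hM : IsColumnAdequate M) {q : Fin n → ℝ} {u : ℕ → Fin n → ℝ}
    (hu : ∀ k, u k ∈ lcpFeasible M q) {c : ℝ} (hc : ∀ k, u k ⬝ᵥ (M *ᵥ u k + q) ≤ c)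
    (hσ : ∀ k : ℕ, (k : ℝ) + 1 < ∑ i, u k i) :
    ∃ d : Fin n → ℝ, (∀ i, 0 ≤ d i) ∧ d ≠ 0 ∧ M *ᵥ d = 0 ∧ ∃ k, ∀ i, u k i = 0 → d i = 0 := by
  set σ : ℕ → ℝ := fun k => ∑ i, u k i with hσd
  have hσ1 : ∀ k, 0 < σ k := fun k => lt_trans (by positivity) (hσ k)
  have hinv : Tendsto (fun k => (σ k)⁻¹) atTop (𝓝 0) := by
    refine tendsto_inv_atTop_zero.comp (tendsto_atTop_mono (fun k => ?_) tendsto_natCast_atTop_atTop)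
    have : (k : ℝ) + 1 < σ k := hσ k
    linarith
  have hmem : ∀ k, (σ k)⁻¹ • u k ∈ stdSimplex ℝ (Fin n) := by
    intro k
    refine ⟨fun i => mul_nonneg (inv_nonneg.2 (hσ1 k).le) (hu k i).1, ?_⟩
    simp only [Pi.smul_apply, smul_eq_mul, ← Finset.mul_sum]
    exact inv_mul_cancel₀ (hσ1 k).ne'
  obtain ⟨d, hd, φ, hφ, hlim⟩ := (isCompact_stdSimplex ℝ (Fin n)).tendsto_subseq hmem
  have hinv' := hinv.comp hφ.tendsto_atTop
  have hMlim : Tendsto (fun k => M *ᵥ ((σ (φ k))⁻¹ • u (φ k)) + (σ (φ k))⁻¹ • q) atTop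
      (𝓝 (M *ᵥ d)) := by
    have h1 : Tendsto (fun k => M *ᵥ ((σ (φ k))⁻¹ • u (φ k))) atTop (𝓝 (M *ᵥ d)) :=
      ((Continuous.matrix_mulVec continuous_const continuous_id).tendsto d).comp hlim
    simpa using h1.add (hinv'.smul_const q)
  have hscale : ∀ k, M *ᵥ ((σ k)⁻¹ • u k) + (σ k)⁻¹ • q = (σ k)⁻¹ • (M *ᵥ u k + q) := by
    intro k; rw [mulVec_smul, smul_add]
  have hMd : ∀ i, 0 ≤ (M *ᵥ d) i := fun i =>
    ge_of_tendsto' ((tendsto_pi_nhds.1 hMlim) i) fun k => by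
      rw [hscale]
      exact mul_nonneg (inv_nonneg.2 (hσ1 _).le) (hu _ i).2
  -- Dividing the bound `c` by σ² sends it to 0. As d ≥ 0 and M d ≥ 0, each term of d ⬝ᵥ M d is then
  -- nonpositive, which is what column adequacy asks for.
  have hdot : d ⬝ᵥ (M *ᵥ d) ≤ 0 := by
    have h1 : Tendsto (fun k => ((σ (φ k))⁻¹ • u (φ k)) ⬝ᵥ
        (M *ᵥ ((σ (φ k))⁻¹ • u (φ k)) + (σ (φ k))⁻¹ • q)) atTop (𝓝 (d ⬝ᵥ (M *ᵥ d))) := by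
      have := (Continuous.dotProduct continuous_fst continuous_snd
        (X := (Fin n → ℝ) × (Fin n → ℝ))).tendsto (d, M *ᵥ d)
      exact this.comp (hlim.prodMk_nhds hMlim)
    have h2 : Tendsto (fun k => (σ (φ k))⁻¹ * ((σ (φ k))⁻¹ * c)) atTop (𝓝 0) := by
      simpa using hinv'.mul (hinv'.mul_const c)
    refine le_of_tendsto_of_tendsto' h1 h2 fun k => ?_
    rw [hscale, smul_dotProduct, dotProduct_smul]
    have := (inv_pos.2 (hσ1 (φ k))).le
    exact mul_le_mul_of_nonneg_left (mul_le_mul_of_nonneg_left (hc _) this) this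
  have hterm : ∀ i, d i * (M *ᵥ d) i ≤ 0 := fun i =>
    (Finset.single_le_sum (f := fun i => d i * (M *ᵥ d) i)
      (fun j _ => mul_nonneg (hd.1 j) (hMd j)) (Finset.mem_univ i)).trans hdot
  refine ⟨d, hd.1, fun h => ?_, hM d hterm, ?_⟩
  · have := hd.2
    simp [h] at this
  -- A coordinate with d i > 0 is eventually positive along the sequence, so some u k can be moved
  -- against d by a ratio step.
  · have hev : ∀ᶠ k in atTop, ∀ i, u (φ k) i = 0 → d i = 0 := by
      refine eventually_all.2 fun i => ?_
      rcases (hd.1 i).eq_or_lt with h | h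
      · exact .of_forall fun _ _ => h.symm
      · filter_upwards [((tendsto_pi_nhds.1 hlim) i).eventually (lt_mem_nhds h)] with k hk h0
        simp [h0] at hk
    obtain ⟨k, hk⟩ := hev.exists
    exact ⟨φ k, hk⟩

/-- The form need not be convex or coercive, so a vanishing multiple of the coordinate sum is added.
A limit point of bounded regularized minimizers minimizes the form. If they are unbounded, some
minimizer can be moved against a nonnegative kernel direction: the form does not increase and the
coordinate sum drops, a contradiction. -/
theorem IsColumnAdequate.exists_min_quadratic {M : Matrix (Fin n) (Fin n) ℝ}
    (hM : IsColumnAdequate M) {q : Fin n → ℝ} (hne : (lcpFeasible M q).Nonempty) :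
    ∃ z ∈ lcpFeasible M q, ∀ y ∈ lcpFeasible M q, z ⬝ᵥ (M *ᵥ z + q) ≤ y ⬝ᵥ (M *ᵥ y + q) := by
  have hcont : Continuous fun z : Fin n → ℝ => z ⬝ᵥ (M *ᵥ z + q) :=
    Continuous.dotProduct continuous_id
      ((Continuous.matrix_mulVec continuous_const continuous_id).add continuous_const)
  have hnn : ∀ z ∈ lcpFeasible M q, 0 ≤ z ⬝ᵥ (M *ᵥ z + q) := fun z hz =>
    Finset.sum_nonneg fun i _ => mul_nonneg (hz i).1 (hz i).2
  choose z hz hmin using fun k : ℕ =>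
    exists_min_add_sum M q hne hcont hnn (ε := 1 / ((k : ℝ) + 1)) (by positivity)
  have hsn : ∀ y ∈ lcpFeasible M q, 0 ≤ ∑ i, y i := fun y hy => Finset.sum_nonneg fun i _ => (hy i).1
  have hle : ∀ k, ∀ y ∈ lcpFeasible M q,
      z k ⬝ᵥ (M *ᵥ z k + q) ≤ y ⬝ᵥ (M *ᵥ y + q) + 1 / ((k : ℝ) + 1) * ∑ i, y i := by
    intro k y hy
    have h1 := hmin k y hy
    have h2 : 0 ≤ 1 / ((k : ℝ) + 1) * ∑ i, z k i := mul_nonneg (by positivity) (hsn _ (hz k))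
    linarith
  by_cases hb : ∃ R : ℝ, ∀ k, ∑ i, z k i ≤ R
  · obtain ⟨R, hR⟩ := hb
    have hin : ∀ k, z k ∈ Set.Icc (0 : Fin n → ℝ) fun _ => R := fun k =>
      ⟨fun i => (hz k i).1, fun i => (Finset.single_le_sum (f := z k)
        (fun j _ => (hz k j).1) (Finset.mem_univ i)).trans (hR k)⟩
    obtain ⟨z', -, φ, hφ, hlim⟩ := isCompact_Icc.tendsto_subseq hin
    refine ⟨z', (isClosed_lcpFeasible M q).mem_of_tendsto hlim (.of_forall fun k => hz _),
      fun y hy => ?_⟩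
    have h2 : Tendsto (fun k => y ⬝ᵥ (M *ᵥ y + q) + 1 / (((φ k : ℕ) : ℝ) + 1) * ∑ i, y i) atTop
        (𝓝 (y ⬝ᵥ (M *ᵥ y + q))) := by
      have := (tendsto_one_div_add_atTop_nhds_zero_nat (𝕜 := ℝ)).comp hφ.tendsto_atTop
      simpa using (this.mul_const (∑ i, y i)).const_add (y ⬝ᵥ (M *ᵥ y + q))
    exact le_of_tendsto_of_tendsto' ((hcont.tendsto z').comp hlim) h2 fun k => hle _ y hy
  · push Not at hb
    choose κ hκ using fun k : ℕ => hb ((k : ℝ) + 1)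
    obtain ⟨y, hy⟩ := hne
    obtain ⟨d, hd0, hd, hMd, k, hk⟩ := hM.exists_kernel_direction (u := fun k => z (κ k))
      (c := y ⬝ᵥ (M *ᵥ y + q) + ∑ i, y i) (fun k => hz _) (fun k => (hle _ y hy).trans (by
        have : 1 / (((κ k : ℕ) : ℝ) + 1) ≤ 1 := by
          rw [div_le_one (by positivity)]
          have : (0 : ℝ) ≤ (κ k : ℕ) := Nat.cast_nonneg _
          linarith
        nlinarith [hsn y hy])) hκ
    exfalso
    obtain ⟨i₀, hi₀⟩ := Function.ne_iff.1 hd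
    have hi₀' : 0 < d i₀ := lt_of_le_of_ne (hd0 i₀) (Ne.symm hi₀)
    obtain ⟨t, ht, htd, -⟩ := exists_ratio_step (fun i => (hz (κ k) i).1) hk ⟨i₀, hi₀'⟩
    have e : M *ᵥ (z (κ k) - t • d) = M *ᵥ z (κ k) := by simp [mulVec_sub, mulVec_smul, hMd]
    have h1 := hmin (κ k) (z (κ k) - t • d) fun i => by
      rw [e]; exact ⟨by simpa using htd i, (hz (κ k) i).2⟩
    rw [e, sub_dotProduct, smul_dotProduct] at h1
    simp only [Pi.sub_apply, Pi.smul_apply, Finset.sum_sub_distrib, smul_eq_mul,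
      ← Finset.mul_sum] at h1
    have h2 : 0 ≤ d ⬝ᵥ (M *ᵥ z (κ k) + q) :=
      Finset.sum_nonneg fun i _ => mul_nonneg (hd0 i) (hz (κ k) i).2
    have h3 : 0 < ∑ i, d i := Finset.sum_pos' (fun i _ => hd0 i) ⟨i₀, Finset.mem_univ _, hi₀'⟩
    have h4 : 0 < 1 / (((κ k : ℕ) : ℝ) + 1) := by positivity
    nlinarith [mul_nonneg ht.le h2, mul_pos h4 (mul_pos ht h3)]

/-- A minimizer of the quadratic form over the feasible set solves the complementarity problem if
the transposed matrix is column adequate. -/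
theorem IsRowAdequate.isLCPSolution_of_min {M : Matrix (Fin n) (Fin n) ℝ} (hM : IsRowAdequate M)
    {q z : Fin n → ℝ} (hz : z ∈ lcpFeasible M q)
    (hmin : ∀ y ∈ lcpFeasible M q, z ⬝ᵥ (M *ᵥ z + q) ≤ y ⬝ᵥ (M *ᵥ y + q)) :
    IsLCPSolution M q z := by
  classical
  set w := M *ᵥ z + q with hw
  -- `L` is the derivative of zᵀ(Mz + q) at z, and `a` collects the active constraints, with 0 for
  -- the inactive ones. A direction nonnegative on all of `a` stays feasible for small steps, so
  -- Farkas supplies multipliers.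
  let L : (Fin n → ℝ) →ₗ[ℝ] ℝ := dotProductBilin ℝ ℝ (w + Mᵀ *ᵥ z)
  let a : Fin n ⊕ Fin n → (Fin n → ℝ) →ₗ[ℝ] ℝ := Sum.elim
    (fun i => if z i = 0 then LinearMap.proj i else 0)
    (fun i => if w i = 0 then LinearMap.proj i ∘ₗ M.mulVecLin else 0)
  have hL : ∀ y, L y = (w + Mᵀ *ᵥ z) ⬝ᵥ y := fun y => rfl
  have key : ∀ y, (∀ i ∈ Finset.univ, 0 ≤ a i y) → 0 ≤ L y := by
    intro y hy
    have hy1 : ∀ i, z i = 0 → 0 ≤ y i := fun i hi => by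
      simpa [a, hi] using hy (Sum.inl i) (Finset.mem_univ _)
    have hy2 : ∀ i, w i = 0 → 0 ≤ (M *ᵥ y) i := fun i hi => by
      simpa [a, hi] using hy (Sum.inr i) (Finset.mem_univ _)
    have small : ∀ b c : ℝ, 0 ≤ b → (b = 0 → 0 ≤ c) → ∀ᶠ t : ℝ in 𝓝[>] 0, 0 ≤ b + t * c := by
      intro b c hb hbc
      rcases hb.eq_or_lt with h | h
      · filter_upwards [self_mem_nhdsWithin] with t ht
        rw [← h, zero_add]
        exact mul_nonneg (le_of_lt ht) (hbc h.symm)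
      · have : Tendsto (fun t : ℝ => b + t * c) (𝓝[>] 0) (𝓝 (b + 0 * c)) :=
          (Continuous.tendsto (by fun_prop) 0).mono_left nhdsWithin_le_nhds
        filter_upwards [this.eventually (lt_mem_nhds (by simpa using h))] with t ht using ht.le
    have hexp : ∀ t : ℝ, (z + t • y) ⬝ᵥ (M *ᵥ (z + t • y) + q)
        = z ⬝ᵥ w + t * (L y + t * (y ⬝ᵥ M *ᵥ y)) := by
      intro t
      have e : M *ᵥ (z + t • y) + q = w + t • (M *ᵥ y) := by
        rw [mulVec_add, mulVec_smul, hw]; abel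
      have e2 : (Mᵀ *ᵥ z) ⬝ᵥ y = z ⬝ᵥ M *ᵥ y := by
        rw [mulVec_transpose, dotProduct_mulVec]
      rw [e, hL, add_dotProduct w, e2, dotProduct_comm w y]
      simp only [add_dotProduct, dotProduct_add, smul_dotProduct, dotProduct_smul, smul_eq_mul]
      ring
    have hev : ∀ᶠ t : ℝ in 𝓝[>] 0, 0 ≤ L y + t * (y ⬝ᵥ M *ᵥ y) := by
      have h1 : ∀ᶠ t : ℝ in 𝓝[>] 0, ∀ i, 0 ≤ z i + t * y i :=
        eventually_all.2 fun i => small _ _ (hz i).1 (hy1 i)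
      have h2 : ∀ᶠ t : ℝ in 𝓝[>] 0, ∀ i, 0 ≤ w i + t * (M *ᵥ y) i :=
        eventually_all.2 fun i => small _ _ (hz i).2 (hy2 i)
      filter_upwards [h1, h2, self_mem_nhdsWithin] with t ht1 ht2 ht
      have hf := hmin (z + t • y) fun i => by
        refine ⟨ht1 i, ?_⟩
        have e : (M *ᵥ (z + t • y) + q) i = w i + t * (M *ᵥ y) i := by
          simp [mulVec_add, mulVec_smul, hw]; ring
        rw [e]; exact ht2 i
      rw [hexp] at hf
      exact nonneg_of_mul_nonneg_right (by linarith) ht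
    have hlim : Tendsto (fun t : ℝ => L y + t * (y ⬝ᵥ M *ᵥ y)) (𝓝[>] 0)
        (𝓝 (L y + 0 * (y ⬝ᵥ M *ᵥ y))) :=
      (Continuous.tendsto (by fun_prop) 0).mono_left nhdsWithin_le_nhds
    simpa using ge_of_tendsto hlim hev
  obtain ⟨c, hc, hLc⟩ := farkas Finset.univ a L key
  let s : Fin n → ℝ := fun i => if z i = 0 then c (Sum.inl i) else 0
  let u : Fin n → ℝ := fun i => if w i = 0 then c (Sum.inr i) else 0
  have hgrad : w + Mᵀ *ᵥ z = s + Mᵀ *ᵥ u := by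
    refine dotProduct_eq _ _ fun y => ?_
    have h1 := LinearMap.congr_fun hLc y
    rw [hL] at h1
    rw [h1, add_dotProduct s, mulVec_transpose, ← dotProduct_mulVec]
    simp only [Fintype.sum_sum_type, a, Sum.elim_inl, Sum.elim_inr, LinearMap.add_apply,
      LinearMap.sum_apply, LinearMap.smul_apply, smul_eq_mul, dotProduct, s, u]
    congr 1 <;> refine Finset.sum_congr rfl fun i _ => ?_
    · split_ifs <;> simp
    · split_ifs <;> simp [mulVec, dotProduct]
  have hT : Mᵀ *ᵥ (z - u) = s - w := by
    rw [mulVec_sub]; linear_combination hgrad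
  -- Here (z - u) i * (s - w) i = -(z i * w i) - u i * s i ≤ 0, because z i * s i = u i * w i = 0.
  -- Row adequacy yields s = w, and z i * s i = 0 becomes complementarity.
  have hzero := hM (z - u) fun i => by
    have h1 : z i * s i = 0 := by
      by_cases hi : z i = 0 <;> simp [s, hi]
    have h2 : u i * w i = 0 := by
      by_cases hi : w i = 0 <;> simp [u, hi]
    have h3 : 0 ≤ s i := by
      by_cases hi : z i = 0 <;> simp [s, hi, hc]
    have h4 : 0 ≤ u i := by
      by_cases hi : w i = 0 <;> simp [u, hi, hc]
    have e : (Mᵀ *ᵥ (z - u)) i = s i - w i := congr_fun hT i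
    rw [e, Pi.sub_apply]
    nlinarith [mul_nonneg (hz i).1 (hz i).2, mul_nonneg h4 h3]
  intro i
  refine ⟨(hz i).1, (hz i).2, ?_⟩
  have h5 : s i = w i := by
    have := congr_fun (hT.symm.trans hzero) i
    simp at this; linarith
  rw [← hw, ← h5]
  by_cases hi : z i = 0 <;> simp [s, hi]

theorem exists_lcpSolution_nonsingular {M : Matrix (Fin n) (Fin n) ℝ}
    (hM : IsAdequate M ∨ IsZMatrix M) {q : Fin n → ℝ} (hne : (lcpFeasible M q).Nonempty) :
    ∃ z, IsLCPSolution M q z ∧ IsUnit (principalSubmatrix M (supp z)).det := by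
  rcases hM with hM | hM
  · obtain ⟨z, hz, hmin⟩ := hM.1.exists_min_quadratic hne
    exact hM.1.exists_solution_nonsingular ⟨z, hM.2.isLCPSolution_of_min hz hmin⟩
  · exact hM.exists_solution hne

end LinearComplementarityExistence

/-! ### Primitives of L² functions and the integral form of H¹. -/

section Primitives

open Filter Topology
open scoped ContDiff

/-- Integration by parts for a `C¹` function and a primitive of an integrable function. -/
theorem integral_mul_eq_sub_primitive {t : ℝ} {r φ : ℝ → ℝ}
    (hr : IntervalIntegrable r volume 0 t) (hφ : ContDiff ℝ 1 φ) (c : ℝ) :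
    ∫ s in (0 : ℝ)..t, φ s * r s = φ t * (c + ∫ s in (0 : ℝ)..t, r s) - φ 0 * c
      - ∫ s in (0 : ℝ)..t, deriv φ s * (c + ∫ τ in (0 : ℝ)..s, r τ) := by
  have hz : AbsolutelyContinuousOnInterval (fun s => c + ∫ τ in (0 : ℝ)..s, r τ) 0 t :=
    (contDiff_const.contDiffOn.absolutelyContinuousOnInterval (f := fun _ : ℝ => c)).add
      (hr.absolutelyContinuousOnInterval_intervalIntegral (by simp))
  have hφa : AbsolutelyContinuousOnInterval φ 0 t := hφ.contDiffOn.absolutelyContinuousOnInterval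
  have hbp := hφa.integral_mul_deriv_eq_deriv_mul hz
  have e : ∫ s in (0 : ℝ)..t, φ s * deriv (fun s => c + ∫ τ in (0 : ℝ)..s, r τ) s
      = ∫ s in (0 : ℝ)..t, φ s * r s := by
    refine intervalIntegral.integral_congr_ae ?_
    filter_upwards [hr.ae_hasDerivAt_integral] with s hs h'
    rw [((hs (uIoc_subset_uIcc h') 0 (by simp)).const_add c).deriv]
  rw [e] at hbp
  simpa using hbp

variable {T : ℝ} {n : ℕ}

theorem L2.integrable (w : L2 T n) : Integrable (fun t => w t) (timeMeasure T) :=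
  (Lp.memLp w).integrable (by norm_num)

theorem norm_setIntegral_le (w : L2 T n) (s : Set ℝ) :
    ‖∫ τ in s, w τ ∂(timeMeasure T)‖
      ≤ ((timeMeasure T univ) ^ (1 / (2 : ℝ))).toReal * ‖w‖ := by
  have h1 : ‖∫ τ in s, w τ ∂(timeMeasure T)‖ ≤ ∫ τ, ‖w τ‖ ∂(timeMeasure T) :=
    (norm_integral_le_integral_norm _).trans
      (setIntegral_le_integral w.integrable.norm (.of_forall fun _ => norm_nonneg _))
  refine h1.trans ?_
  have hm := Lp.aestronglyMeasurable w
  rw [integral_norm_eq_lintegral_enorm hm, ← eLpNorm_one_eq_lintegral_enorm, Lp.norm_def, mul_comm,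
    ← ENNReal.toReal_mul]
  have h2 := eLpNorm_le_eLpNorm_mul_rpow_measure_univ (p := 1) (q := 2) (μ := timeMeasure T)
    (by norm_num) hm
  have e : (1 / (1 : ENNReal).toReal - 1 / (2 : ENNReal).toReal) = 1 / (2 : ℝ) := by norm_num
  rw [e] at h2
  refine ENNReal.toReal_mono (ENNReal.mul_ne_top (Lp.eLpNorm_ne_top w) ?_) h2
  exact ENNReal.rpow_ne_top_of_nonneg (by norm_num) (measure_ne_top _ _)

/-- The integral `w ↦ ∫₀ᵗ w(s) ds` as a continuous linear map on `L²`. -/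
noncomputable def prim (T : ℝ) (n : ℕ) (t : ℝ) : L2 T n →L[ℝ] Vec n :=
  LinearMap.mkContinuous
    { toFun := fun w => ∫ s in Ioc 0 t, w s ∂(timeMeasure T)
      map_add' := fun v w => by
        rw [← integral_add v.integrable.integrableOn w.integrable.integrableOn]
        exact integral_congr_ae (ae_restrict_of_ae (Lp.coeFn_add v w))
      map_smul' := fun c w => by
        rw [RingHom.id_apply, ← integral_smul]
        exact integral_congr_ae (ae_restrict_of_ae (Lp.coeFn_smul c w)) }
    _ fun w => norm_setIntegral_le w _

theorem prim_apply (w : L2 T n) (t : ℝ) :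
    prim T n t w = ∫ s in Ioc 0 t, w s ∂(timeMeasure T) := rfl

theorem restrict_Ioc_timeMeasure {t : ℝ} (ht : t ∈ Icc 0 T) :
    (timeMeasure T).restrict (Ioc 0 t) = volume.restrict (Ioc 0 t) := by
  rw [timeMeasure, Measure.restrict_congr_set Ioo_ae_eq_Ioc,
    Measure.restrict_restrict measurableSet_Ioc, inter_eq_left.2 (Ioc_subset_Ioc_right ht.2)]

theorem prim_eq_intervalIntegral (w : L2 T n) {t : ℝ} (ht : t ∈ Icc 0 T) :
    prim T n t w = ∫ s in (0 : ℝ)..t, w s := by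
  rw [prim_apply, restrict_Ioc_timeMeasure ht, intervalIntegral.integral_of_le ht.1]

theorem L2.intervalIntegrable (w : L2 T n) {t : ℝ} (ht : t ∈ Icc 0 T) :
    IntervalIntegrable (fun s => w s) volume 0 t := by
  rw [intervalIntegrable_iff_integrableOn_Ioc_of_le ht.1, IntegrableOn,
    ← restrict_Ioc_timeMeasure ht]
  exact w.integrable.integrableOn

theorem L2.intervalIntegrable_coord (w : L2 T n) {t : ℝ} (ht : t ∈ Icc 0 T) (i : Fin n) :
    IntervalIntegrable (fun s => w s i) volume 0 t := by
  have h := w.intervalIntegrable ht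
  rw [intervalIntegrable_iff] at h ⊢
  exact (EuclideanSpace.proj (𝕜 := ℝ) i).integrable_comp h

theorem prim_coord (w : L2 T n) {t : ℝ} (ht : t ∈ Icc 0 T) (i : Fin n) :
    prim T n t w i = ∫ s in (0 : ℝ)..t, w s i := by
  rw [prim_eq_intervalIntegral w ht]
  exact ((EuclideanSpace.proj (𝕜 := ℝ) i).intervalIntegral_comp_comm
    (w.intervalIntegrable ht)).symm

theorem continuousOn_prim (hT : 0 < T) (w : L2 T n) :
    ContinuousOn (fun t => prim T n t w) (Icc 0 T) := by
  have h : ContinuousOn (fun t => ∫ s in (0 : ℝ)..t, w s) (Icc 0 T) := by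
    have hii := w.intervalIntegrable (right_mem_Icc.2 hT.le)
    rw [intervalIntegrable_iff_integrableOn_Icc_of_le hT.le, ← uIcc_of_le hT.le] at hii
    simpa [uIcc_of_le hT.le] using intervalIntegral.continuousOn_primitive_interval hii
  exact h.congr fun t ht => prim_eq_intervalIntegral w ht

theorem ae_mem_Ioo : ∀ᵐ t ∂(timeMeasure T), t ∈ Ioo 0 T := ae_restrict_mem measurableSet_Ioo

/-- A primitive of an `L²` function is in `H¹`. -/
theorem exists_H1_of_primitive (hT : 0 < T) {x w : L2 T n} {a : Vec n}
    (h : ∀ᵐ t ∂(timeMeasure T), x t = a + prim T n t w) :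
    ∃ X : H1 T n, X.toL2 = x ∧ X.deriv = w ∧ X.rep 0 = a ∧ X.rep T = a + prim T n T w := by
  have hTT : T ∈ Icc 0 T := right_mem_Icc.2 hT.le
  have hweak : IsWeakDeriv x w := by
    intro i φ h1 h2 h3
    have hφ0 : φ 0 = 0 := by
      by_contra h0; exact lt_irrefl _ (h3 (subset_tsupport _ h0)).1
    have hφT : φ T = 0 := by
      by_contra h0; exact lt_irrefl _ (h3 (subset_tsupport _ h0)).2
    have hbp := integral_mul_eq_sub_primitive (w.intervalIntegrable_coord hTT i)
      (h1.of_le (by exact_mod_cast le_top)) (a i)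
    rw [hφ0, hφT, intervalIntegral.integral_of_le hT.le, intervalIntegral.integral_of_le hT.le,
      intervalIntegral.integral_of_le hT.le, integral_Ioc_eq_integral_Ioo,
      integral_Ioc_eq_integral_Ioo (f := fun s => deriv φ s * _)] at hbp
    have e : ∫ t in Ioo 0 T, deriv φ t * x t i
        = ∫ t in Ioo 0 T, deriv φ t * (a i + ∫ τ in (0 : ℝ)..t, w τ i) := by
      refine integral_congr_ae ?_
      filter_upwards [h, ae_mem_Ioo] with t ht hm
      rw [ht, PiLp.add_apply, prim_coord w (Ioo_subset_Icc_self hm)]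
    rw [e]; linarith
  let X : H1 T n := ⟨x, w, hweak⟩
  have hrep : EqOn (fun t => a + prim T n t w) X.rep (Icc 0 T) :=
    X.rep_unique hT (continuousOn_const.add (continuousOn_prim hT w)) (by
      filter_upwards [h] with t ht using ht.symm)
  refine ⟨X, rfl, rfl, ?_, (hrep hTT).symm⟩
  rw [← hrep (left_mem_Icc.2 hT.le)]
  simp [prim_apply]

/-- With `exists_H1_of_primitive` this makes the differential equation equivalent to an integral
equation, stated through continuous maps on L² and hence stable under limits. -/
theorem H1.rep_eq_primitive (hT : 0 < T) (X : H1 T n) :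
    ∀ t ∈ Icc 0 T, X.rep t = X.rep 0 + prim T n t X.deriv := by
  choose c hc using fun i => ae_eq_primitive hT (L2.integrable_coord X.toL2 i)
    (L2.integrable_coord X.deriv i) (X.isWeakDeriv i)
  have hrep : EqOn (fun t => WithLp.toLp 2 c + prim T n t X.deriv) X.rep (Icc 0 T) :=
    X.rep_unique hT (continuousOn_const.add (continuousOn_prim hT X.deriv)) (by
      filter_upwards [ae_all_iff.2 hc, ae_mem_Ioo] with t ht hm
      ext i
      rw [ht i, PiLp.add_apply, prim_coord _ (Ioo_subset_Icc_self hm)])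
  have h0 := hrep (left_mem_Icc.2 hT.le)
  intro t ht
  rw [← hrep ht, ← h0]
  simp [prim_apply]

theorem H1.toL2_eq_primitive (hT : 0 < T) (X : H1 T n) :
    ∀ᵐ t ∂(timeMeasure T), X.toL2 t = X.rep 0 + prim T n t X.deriv := by
  filter_upwards [X.rep_spec.2, ae_mem_Ioo] with t ht hm
  rw [← ht, X.rep_eq_primitive hT t (Ioo_subset_Icc_self hm)]

/-- Pointwise multiplication by a constant matrix, as a continuous linear map on `L²`. -/
noncomputable def matL (T : ℝ) {a b : ℕ} (M : Matrix (Fin a) (Fin b) ℝ) : L2 T b →L[ℝ] L2 T a :=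
  (Matrix.toEuclideanLin M).toContinuousLinearMap.compLpL 2 (timeMeasure T)

theorem coeFn_matL {a b : ℕ} (M : Matrix (Fin a) (Fin b) ℝ) (x : L2 T b) :
    ∀ᵐ t ∂(timeMeasure T), matL T M x t = Matrix.toEuclideanLin M (x t) :=
  (Matrix.toEuclideanLin M).toContinuousLinearMap.coeFn_compLpL x

theorem matL_mul {a b c : ℕ} (M : Matrix (Fin a) (Fin b) ℝ) (N : Matrix (Fin b) (Fin c) ℝ)
    (x : L2 T c) : matL T (M * N) x = matL T M (matL T N x) := by
  refine Lp.ext ?_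
  filter_upwards [coeFn_matL (M * N) x, coeFn_matL M (matL T N x), coeFn_matL N x] with t h1 h2 h3
  rw [h1, h2, h3]
  simp [Matrix.toLpLin_apply, Matrix.mulVec_mulVec]

theorem matL_sub {a b : ℕ} (M N : Matrix (Fin a) (Fin b) ℝ) (x : L2 T b) :
    matL T (M - N) x = matL T M x - matL T N x := by
  refine Lp.ext ?_
  filter_upwards [coeFn_matL (M - N) x, coeFn_matL M x, coeFn_matL N x,
    Lp.coeFn_sub (matL T M x) (matL T N x)] with t h1 h2 h3 h4
  rw [h1, h4, Pi.sub_apply, h2, h3, map_sub, LinearMap.sub_apply]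

theorem matL_one {a : ℕ} (x : L2 T a) : matL T (1 : Matrix (Fin a) (Fin a) ℝ) x = x := by
  refine Lp.ext ?_
  filter_upwards [coeFn_matL (1 : Matrix (Fin a) (Fin a) ℝ) x] with t h1
  rw [h1]; simp

theorem matL_zero {a b : ℕ} (x : L2 T b) : matL T (0 : Matrix (Fin a) (Fin b) ℝ) x = 0 := by
  refine Lp.ext ?_
  filter_upwards [coeFn_matL (0 : Matrix (Fin a) (Fin b) ℝ) x,
    Lp.coeFn_zero (Vec a) 2 (timeMeasure T)] with t h1 h2
  rw [h1, h2]; simp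

end Primitives

/-! ### The matrix exponential and variation of constants. -/

section Flow

open Filter Topology

variable {T : ℝ} {n : ℕ}

/-- A square matrix as a continuous linear map of Euclidean space. -/
noncomputable def opL (G : Matrix (Fin n) (Fin n) ℝ) : Vec n →L[ℝ] Vec n :=
  (Matrix.toEuclideanLin G).toContinuousLinearMap

theorem opL_apply (G : Matrix (Fin n) (Fin n) ℝ) (v : Vec n) :
    opL G v = Matrix.toEuclideanLin G v := rfl

variable {E : Type*} [NormedAddCommGroup E] [NormedSpace ℝ E]

/-- The flow `exp(t G)` of the linear system `x' = G x`. -/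
noncomputable def flow (G : E →L[ℝ] E) (t : ℝ) : E →L[ℝ] E :=
  NormedSpace.exp (t • G)

theorem flow_zero_apply (G : E →L[ℝ] E) (v : E) : flow G 0 v = v := by
  simp [flow, NormedSpace.exp_zero]

variable [CompleteSpace E]

theorem hasDerivAt_flow (G : E →L[ℝ] E) (t : ℝ) : HasDerivAt (flow G) (G ∘L flow G t) t :=
  hasDerivAt_exp_smul_const' G t

theorem hasDerivAt_flow' (G : E →L[ℝ] E) (t : ℝ) : HasDerivAt (flow G) (flow G t ∘L G) t :=
  hasDerivAt_exp_smul_const G t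

theorem continuous_flow (G : E →L[ℝ] E) : Continuous (flow G) :=
  continuous_iff_continuousAt.2 fun t => (hasDerivAt_flow G t).continuousAt

theorem flow_flow_neg_apply (G : E →L[ℝ] E) (t : ℝ) (v : E) : flow G t (flow G (-t) v) = v := by
  let : NormedAlgebra ℚ (E →L[ℝ] E) := NormedAlgebra.restrictScalars ℚ ℝ _
  have h : flow G t * flow G (-t) = 1 := by
    rw [flow, flow, ← NormedSpace.exp_add_of_commute, ← add_smul, add_neg_cancel, zero_smul,
      NormedSpace.exp_zero]
    exact ((Commute.refl _).smul_left _).smul_right _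
  exact DFunLike.congr_fun h v

theorem hasDerivAt_flow_apply (G : E →L[ℝ] E) (v : E) (t : ℝ) :
    HasDerivAt (fun t => flow G t v) (G (flow G t v)) t :=
  (ContinuousLinearMap.apply ℝ E v).hasFDerivAt.comp_hasDerivAt t (hasDerivAt_flow G t)

theorem hasDerivAt_flow_apply' (G : E →L[ℝ] E) (v : E) (t : ℝ) :
    HasDerivAt (fun t => flow G t v) (flow G t (G v)) t :=
  (ContinuousLinearMap.apply ℝ E v).hasFDerivAt.comp_hasDerivAt t (hasDerivAt_flow' G t)

/-- Reduces the operator product rule to scalar integration by parts, entry by entry. -/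
theorem clm_apply_coord {m : ℕ} (L : Vec n →L[ℝ] Vec m) (v : Vec n) (i : Fin m) :
    L v i = ∑ j, L (EuclideanSpace.single j 1) i * v j := by
  have h : v = ∑ j, v j • EuclideanSpace.single j (1 : ℝ) := by
    ext k; simp [Finset.sum_apply, Pi.single_apply]
  conv_lhs => rw [h]
  simp [mul_comm]

/-- A continuous family of operators applied to an integrable function. -/
theorem intervalIntegrable_clm_apply {m : ℕ} {L : ℝ → Vec n →L[ℝ] Vec m} (hL : Continuous L)
    {w : ℝ → Vec n} {t : ℝ} (hw : IntervalIntegrable w volume 0 t) :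
    IntervalIntegrable (fun s => L s (w s)) volume 0 t := by
  obtain ⟨c, hc⟩ := (isCompact_uIcc (a := (0 : ℝ)) (b := t)).exists_bound_of_continuousOn
    hL.continuousOn
  rw [intervalIntegrable_iff] at hw ⊢
  refine (hw.norm.const_mul c).mono' ?_ ?_
  · exact isBoundedBilinearMap_apply.continuous.comp_aestronglyMeasurable
      (hL.aestronglyMeasurable.prodMk hw.aestronglyMeasurable)
  · filter_upwards [ae_restrict_mem measurableSet_uIoc] with s hs
    exact ((L s).le_opNorm _).trans
      (mul_le_mul_of_nonneg_right (hc s (uIoc_subset_uIcc hs)) (norm_nonneg _))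

theorem intervalIntegral_coord {f : ℝ → Vec n} {t : ℝ} (hf : IntervalIntegrable f volume 0 t)
    (i : Fin n) : (∫ s in (0 : ℝ)..t, f s) i = ∫ s in (0 : ℝ)..t, f s i :=
  ((EuclideanSpace.proj (𝕜 := ℝ) i).intervalIntegral_comp_comm hf).symm

theorem intervalIntegrable_coord {f : ℝ → Vec n} {t : ℝ} (hf : IntervalIntegrable f volume 0 t)
    (i : Fin n) : IntervalIntegrable (fun s => f s i) volume 0 t := by
  rw [intervalIntegrable_iff] at hf ⊢
  exact (EuclideanSpace.proj (𝕜 := ℝ) i).integrable_comp hf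

/-- The product rule, in integrated form, for the flow and a primitive. -/
theorem integral_flow_apply (G : Vec n →L[ℝ] Vec n) (a : Vec n) {r : ℝ → Vec n} {t : ℝ}
    (hr : IntervalIntegrable r volume 0 t) :
    ∫ s in (0 : ℝ)..t, flow G s (r s) = flow G t (a + ∫ s in (0 : ℝ)..t, r s) - a
      - ∫ s in (0 : ℝ)..t,
          G (flow G s (a + ∫ τ in (0 : ℝ)..s, r τ)) := by
  set y : ℝ → Vec n := fun s => a + ∫ τ in (0 : ℝ)..s, r τ with hy
  have hsub : ∀ s ∈ uIcc 0 t, IntervalIntegrable r volume 0 s := fun s hs =>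
    hr.mono_set (uIcc_subset_uIcc_left hs)
  have hyc : ContinuousOn y (uIcc 0 t) :=
    continuousOn_const.add (intervalIntegral.continuousOn_primitive_interval'
      hr left_mem_uIcc)
  have hyi : IntervalIntegrable y volume 0 t := hyc.intervalIntegrable
  have hcG : Continuous fun s => G ∘L flow G s := continuous_const.clm_comp (continuous_flow G)
  have hi2 : IntervalIntegrable (fun s => (G ∘L flow G s) (y s)) volume 0 t :=
    intervalIntegrable_clm_apply hcG hyi
  have hi1 := intervalIntegrable_clm_apply (continuous_flow G) hr
  have hder : ∀ i j s, HasDerivAt (fun s => flow G s (EuclideanSpace.single j 1) i)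
      ((G ∘L flow G s) (EuclideanSpace.single j 1) i) s := by
    intro i j s
    have h1 := hasDerivAt_flow_apply G (EuclideanSpace.single j (1 : ℝ)) s
    have h2 := (EuclideanSpace.proj (𝕜 := ℝ) i).hasFDerivAt.comp_hasDerivAt s h1
    exact h2
  have hcont : ∀ (L : ℝ → Vec n →L[ℝ] Vec n), Continuous L → ∀ i j,
      Continuous fun s => L s (EuclideanSpace.single j 1) i := fun L hL i j =>
    (EuclideanSpace.proj (𝕜 := ℝ) i).continuous.comp (hL.clm_apply continuous_const)
  have hC1 : ∀ i j, ContDiff ℝ 1 fun s => flow G s (EuclideanSpace.single j 1) i := by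
    intro i j
    refine contDiff_one_iff_deriv.2 ⟨fun s => (hder i j s).differentiableAt, ?_⟩
    rw [funext fun s => (hder i j s).deriv]
    exact hcont _ hcG i j
  ext i
  have hbp := fun j => integral_mul_eq_sub_primitive (intervalIntegrable_coord hr j) (hC1 i j) (a j)
  have e1 : (∫ s in (0 : ℝ)..t, flow G s (r s)) i
      = ∑ j, ∫ s in (0 : ℝ)..t, flow G s (EuclideanSpace.single j 1) i * r s j := by
    rw [intervalIntegral_coord hi1, ← intervalIntegral.integral_finsetSum]
    · simp_rw [← clm_apply_coord]
    · intro j _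
      exact (intervalIntegrable_coord hr j).continuousOn_mul (hcont _ (continuous_flow G) i j).continuousOn
  have e2 : (∫ s in (0 : ℝ)..t, (G ∘L flow G s) (y s)) i
      = ∑ j, ∫ s in (0 : ℝ)..t, (G ∘L flow G s) (EuclideanSpace.single j 1) i * y s j := by
    rw [intervalIntegral_coord hi2, ← intervalIntegral.integral_finsetSum]
    · simp_rw [← clm_apply_coord]
    · intro j _
      exact (intervalIntegrable_coord hyi j).continuousOn_mul (hcont _ hcG i j).continuousOn
  have e3 : ∀ j, ∀ s ∈ uIcc 0 t, a j + ∫ τ in (0 : ℝ)..s, r τ j = y s j := fun j s hs => by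
    rw [hy, PiLp.add_apply, intervalIntegral_coord (hsub s hs)]
  have e4 : ∀ j, ∫ s in (0 : ℝ)..t, deriv (fun s => flow G s (EuclideanSpace.single j 1) i) s *
        (a j + ∫ τ in (0 : ℝ)..s, r τ j)
      = ∫ s in (0 : ℝ)..t, (G ∘L flow G s) (EuclideanSpace.single j 1) i * y s j := fun j =>
    intervalIntegral.integral_congr fun s hs => by
      show deriv _ s * _ = _
      rw [(hder i j s).deriv, e3 j s hs]
  have e5 : ∑ j, flow G 0 (EuclideanSpace.single j 1) i * a j = a i := by
    rw [← clm_apply_coord, flow_zero_apply]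
  show _ = (flow G t (y t)) i - a i - (∫ s in (0 : ℝ)..t, (G ∘L flow G s) (y s)) i
  rw [e1, e2, Finset.sum_congr rfl fun j _ => hbp j]
  simp only [e4, e3 _ t right_mem_uIcc, Finset.sum_sub_distrib, e5, ← clm_apply_coord]

/-- Variation of constants: a solution of `x' = G x + w`, `x(0) = a`, and its terminal value. -/
theorem exists_solution (hT : 0 < T) (G : Matrix (Fin n) (Fin n) ℝ) (a : Vec n) (w : L2 T n) :
    ∃ x : L2 T n, (∀ᵐ t ∂(timeMeasure T), x t = a + prim T n t (matL T G x + w)) ∧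
      a + prim T n T (matL T G x + w)
        = flow (opL G) T (a + ∫ s in (0 : ℝ)..T, flow (opL G) (-s) (w s)) := by
  have hTT : T ∈ Icc 0 T := right_mem_Icc.2 hT.le
  set r : ℝ → Vec n := fun s => flow (opL G) (-s) (w s) with hr
  have hri : ∀ t ∈ Icc 0 T, IntervalIntegrable r volume 0 t := fun t ht =>
    intervalIntegrable_clm_apply ((continuous_flow (opL G)).comp continuous_neg) (w.intervalIntegrable ht)
  set X : ℝ → Vec n := fun t => flow (opL G) t (a + ∫ s in (0 : ℝ)..t, r s) with hX
  have hXc : ContinuousOn X (Icc 0 T) := by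
    refine (continuous_flow (opL G)).continuousOn.clm_apply (continuousOn_const.add ?_)
    have := intervalIntegral.continuousOn_primitive_interval' (hri T hTT) left_mem_uIcc
    rwa [uIcc_of_le hT.le] at this
  obtain ⟨c, hc⟩ := isCompact_Icc.exists_bound_of_continuousOn hXc
  have hmem : MemLp X 2 (timeMeasure T) := by
    refine MemLp.of_bound ((hXc.mono Ioo_subset_Icc_self).aestronglyMeasurable measurableSet_Ioo) c ?_
    filter_upwards [ae_mem_Ioo] with t ht using hc t (Ioo_subset_Icc_self ht)
  set x : L2 T n := hmem.toLp X with hx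
  have hxX : ∀ᵐ t ∂(timeMeasure T), x t = X t := hmem.coeFn_toLp
  have key : ∀ t ∈ Icc 0 T, X t = a + prim T n t (matL T G x + w) := by
    intro t ht
    -- Since exp(sG) r(s) = w(s), the product rule reads ∫ w = X(t) - a - ∫ G X, which is the
    -- integral equation.
    have h1 := integral_flow_apply (opL G) a (hri t ht)
    have e1 : ∫ s in (0 : ℝ)..t, flow (opL G) s (r s) = prim T n t w := by
      rw [prim_eq_intervalIntegral _ ht]
      simp only [hr, flow_flow_neg_apply]
    have e2 : ∫ s in (0 : ℝ)..t, opL G (X s)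
        = prim T n t (matL T G x) := by
      rw [prim_apply, restrict_Ioc_timeMeasure ht, intervalIntegral.integral_of_le ht.1,
        ← restrict_Ioc_timeMeasure ht]
      refine integral_congr_ae (ae_restrict_of_ae ?_)
      filter_upwards [hxX, coeFn_matL G x] with s h1 h2
      rw [h2, h1]; rfl
    rw [e1, e2] at h1
    rw [map_add, h1, hX]
    abel
  refine ⟨x, ?_, (key T hTT).symm⟩
  filter_upwards [hxX, ae_mem_Ioo] with t h1 h2
  rw [h1, key t (Ioo_subset_Icc_self h2)]

end Flow

/-! ### The Kalman condition and reachability under the path constraint. -/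

section Controllability

open Filter Topology

variable {T : ℝ} {n m l r : ℕ}

theorem mulVec_surjective_of_rank {ι : Type*} [Fintype ι] {N : Matrix (Fin n) ι ℝ}
    (h : N.rank = n) : Function.Surjective N.mulVec := by
  have : LinearMap.range N.mulVecLin = ⊤ :=
    Submodule.eq_top_of_finrank_eq (by rw [← Matrix.rank, h]; simp)
  exact LinearMap.range_eq_top.1 this

theorem mul_pinv {D : Matrix (Fin l) (Fin m) ℝ} (h : D.rank = l) : D * pinv D = 1 := by
  have h1 : (D * D.transpose).rank = l := by rw [Matrix.rank_self_mul_transpose, h]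
  have h2 : IsUnit (D * D.transpose) :=
    Matrix.mulVec_surjective_iff_isUnit.1 (mulVec_surjective_of_rank h1)
  rw [pinv, ← Matrix.mul_assoc, Matrix.mul_nonsing_inv _ ((Matrix.isUnit_iff_isUnit_det _).1 h2)]

/-- The column of `Gᵏ N` with index `j`. -/
noncomputable def krylovColumn (G : Matrix (Fin n) (Fin n) ℝ) (N : Matrix (Fin n) (Fin r) ℝ)
    (k : ℕ) (j : Fin r) : Vec n :=
  WithLp.toLp 2 fun i => (G ^ k * N) i j

theorem opL_krylovColumn (G : Matrix (Fin n) (Fin n) ℝ) (N : Matrix (Fin n) (Fin r) ℝ)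
    (k : ℕ) (j : Fin r) : opL G (krylovColumn G N k j) = krylovColumn G N (k + 1) j := by
  rw [opL_apply, krylovColumn, krylovColumn, Matrix.toLpLin_apply, pow_succ', Matrix.mul_assoc]
  rfl

theorem toEuclideanLin_eq_sum (G : Matrix (Fin n) (Fin n) ℝ) (N : Matrix (Fin n) (Fin r) ℝ)
    (c : Vec r) : Matrix.toEuclideanLin N c = ∑ j, c j • krylovColumn G N 0 j := by
  ext i
  simp [krylovColumn, Matrix.toLpLin_apply, Matrix.mulVec, dotProduct, mul_comm]

theorem exists_eq_sum_krylovColumn {G : Matrix (Fin n) (Fin n) ℝ} {N : Matrix (Fin n) (Fin r) ℝ}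
    (h : (krylovMatrix G N).rank = n) (y : Vec n) :
    ∃ c : Fin n × Fin r → ℝ, y = ∑ kj, c kj • krylovColumn G N kj.1 kj.2 := by
  obtain ⟨c, hc⟩ := mulVec_surjective_of_rank h y.ofLp
  refine ⟨c, ?_⟩
  ext i
  rw [← hc]
  simp [krylovColumn, krylovMatrix, Matrix.mulVec, dotProduct, mul_comm]

/-- If `⟪exp(-sG) N c, η⟫ = 0` for all `c` and all `s` in an interval, then `η = 0`. -/
theorem eq_zero_of_inner_flow_eq_zero (hT : 0 < T) {G : Matrix (Fin n) (Fin n) ℝ}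
    {N : Matrix (Fin n) (Fin r) ℝ} (h : (krylovMatrix G N).rank = n) {η : Vec n}
    (hη : ∀ j, ∀ s ∈ Ioo 0 T, inner ℝ (flow (opL G) (-s) (krylovColumn G N 0 j)) η = 0) :
    η = 0 := by
  -- Differentiating in s an expression that vanishes on the open interval replaces the column of Gᵏ
  -- N by that of Gᵏ⁺¹ N, up to sign. By the rank condition these columns span, and exp(-sG) is
  -- invertible.
  have hk : ∀ k j, ∀ s ∈ Ioo 0 T,
      inner ℝ (flow (opL G) (-s) (krylovColumn G N k j)) η = 0 := by
    intro k
    induction k with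
    | zero => exact hη
    | succ k ih =>
      intro j s hs
      have h1 : HasDerivAt (fun s => flow (opL G) (-s) (krylovColumn G N k j))
          ((-1 : ℝ) • flow (opL G) (-s) (opL G (krylovColumn G N k j))) s :=
        (hasDerivAt_flow_apply' (opL G) (krylovColumn G N k j) (-s)).scomp s (hasDerivAt_neg s)
      have h2 := h1.inner ℝ (hasDerivAt_const s η)
      have h3 : HasDerivAt (fun s => inner ℝ (flow (opL G) (-s) (krylovColumn G N k j)) η) 0 s :=
        (hasDerivAt_const s (0 : ℝ)).congr_of_eventuallyEq (by
          filter_upwards [isOpen_Ioo.mem_nhds hs] with τ hτ using ih j τ hτ)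
      have h4 := h2.unique h3
      rw [opL_krylovColumn] at h4
      simpa using h4
  have hs : T / 2 ∈ Ioo 0 T := ⟨by linarith, by linarith⟩
  have hall : ∀ y, inner ℝ (flow (opL G) (-(T / 2)) y) η = 0 := by
    intro y
    obtain ⟨c, rfl⟩ := exists_eq_sum_krylovColumn h y
    simp only [map_sum, map_smul, sum_inner, inner_smul_left]
    exact Finset.sum_eq_zero fun kj _ => by rw [hk _ _ _ hs, mul_zero]
  have h5 := hall (flow (opL G) (-(-(T / 2))) η)
  rw [flow_flow_neg_apply] at h5
  exact inner_self_eq_zero.1 h5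

/-- Under the Kalman rank condition, the states that the controls can reach are all of `ℝⁿ`. -/
theorem exists_control (hT : 0 < T) {G : Matrix (Fin n) (Fin n) ℝ}
    {N : Matrix (Fin n) (Fin r) ℝ} (h : (krylovMatrix G N).rank = n) (y : Vec n) :
    ∃ v : L2 T r, ∫ s in (0 : ℝ)..T, flow (opL G) (-s) (matL T N v s) = y := by
  have hTT : T ∈ Icc 0 T := right_mem_Icc.2 hT.le
  have hcf : Continuous fun s => flow (opL G) (-s) := (continuous_flow (opL G)).comp continuous_neg
  have hint : ∀ w : L2 T n, IntervalIntegrable (fun s => flow (opL G) (-s) (w s)) volume 0 T :=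
    fun w => intervalIntegrable_clm_apply hcf (w.intervalIntegrable hTT)
  have hae : ∀ {w w' : ℝ → Vec n}, (∀ᵐ s ∂(timeMeasure T), w s = w' s) →
      ∫ s in (0 : ℝ)..T, flow (opL G) (-s) (w s) = ∫ s in (0 : ℝ)..T, flow (opL G) (-s) (w' s) := by
    intro w w' hww
    rw [intervalIntegral.integral_of_le hT.le, intervalIntegral.integral_of_le hT.le,
      integral_Ioc_eq_integral_Ioo, integral_Ioc_eq_integral_Ioo]
    refine integral_congr_ae ?_
    filter_upwards [hww] with s hs
    rw [hs]
  let R : L2 T r →ₗ[ℝ] Vec n :=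
    { toFun := fun v => ∫ s in (0 : ℝ)..T, flow (opL G) (-s) (matL T N v s)
      map_add' := fun v w => by
        rw [← intervalIntegral.integral_add (hint _) (hint _), map_add]
        refine (hae (Lp.coeFn_add (matL T N v) (matL T N w))).trans ?_
        simp only [Pi.add_apply, map_add]
      map_smul' := fun c v => by
        rw [RingHom.id_apply, ← intervalIntegral.integral_smul, map_smul]
        refine (hae (Lp.coeFn_smul c (matL T N v))).trans ?_
        simp only [Pi.smul_apply, map_smul] }
  suffices hR : LinearMap.range R = ⊤ from LinearMap.range_eq_top.1 hR y
  -- In finite dimension the range is everything once its orthogonal complement is zero. For η in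
  -- that complement, the control `V` below is the adjoint of `R` applied to η, so ⟪R V, η⟫ = ∫ ∑ φ
  -- j ^ 2 must vanish.
  rw [← Submodule.orthogonal_eq_bot_iff, Submodule.eq_bot_iff]
  intro η hη
  have hRη : ∀ v, inner ℝ (R v) η = 0 := fun v =>
    (Submodule.mem_orthogonal _ _).1 hη _ (LinearMap.mem_range_self R v)
  let φ : Fin r → ℝ → ℝ := fun j s => inner ℝ (flow (opL G) (-s) (krylovColumn G N 0 j)) η
  have hφ : ∀ j, Continuous (φ j) := fun j =>
    (hcf.clm_apply continuous_const).inner continuous_const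
  let V : ℝ → Vec r := fun s => WithLp.toLp 2 fun j => φ j s
  have hV : Continuous V := (PiLp.continuous_toLp 2 _).comp (continuous_pi hφ)
  obtain ⟨c, hc⟩ := (isCompact_Icc (a := (0 : ℝ)) (b := T)).exists_bound_of_continuousOn
    hV.continuousOn
  have hmem : MemLp V 2 (timeMeasure T) := by
    refine MemLp.of_bound hV.aestronglyMeasurable c ?_
    filter_upwards [ae_mem_Ioo] with t ht using hc t (Ioo_subset_Icc_self ht)
  have hval : inner ℝ (R (hmem.toLp V)) η = ∫ s in (0 : ℝ)..T, ∑ j, φ j s ^ 2 := by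
    have e1 : R (hmem.toLp V) = ∫ s in (0 : ℝ)..T, flow (opL G) (-s) (Matrix.toEuclideanLin N (V s)) := by
      refine hae ?_
      filter_upwards [coeFn_matL N (hmem.toLp V), hmem.coeFn_toLp] with s h1 h2
      rw [h1, h2]
    have hNV : Continuous fun s => Matrix.toEuclideanLin N (V s) :=
      (Matrix.toEuclideanLin N).toContinuousLinearMap.continuous.comp hV
    rw [e1, real_inner_comm]
    have e2 := (innerSL ℝ η).intervalIntegral_comp_comm (a := 0) (b := T) (μ := volume)
      (f := fun s => flow (opL G) (-s) (Matrix.toEuclideanLin N (V s)))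
      ((hcf.clm_apply hNV).intervalIntegrable _ _)
    simp only [innerSL_apply_apply] at e2
    rw [← e2]
    refine intervalIntegral.integral_congr fun s _ => ?_
    show inner ℝ η (flow (opL G) (-s) (Matrix.toEuclideanLin N (V s))) = _
    rw [toEuclideanLin_eq_sum G]
    simp only [map_sum, map_smul, inner_sum, inner_smul_right]
    refine Finset.sum_congr rfl fun j _ => ?_
    rw [real_inner_comm, sq]
  have hcont : Continuous fun s => ∑ j, φ j s ^ 2 := continuous_finsetSum _ fun j _ => (hφ j).pow 2
  have hnn : ∀ s, 0 ≤ ∑ j, φ j s ^ 2 := fun s => Finset.sum_nonneg fun j _ => sq_nonneg _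
  have hzero : ∀ s ∈ Icc 0 T, ∑ j, φ j s ^ 2 = 0 := by
    have h0 : ∫ s in Icc 0 T, ∑ j, φ j s ^ 2 = 0 := by
      rw [integral_Icc_eq_integral_Ioc, ← intervalIntegral.integral_of_le hT.le, ← hval, hRη]
    have h1 := (integral_eq_zero_iff_of_nonneg_ae (.of_forall hnn)
      (hcont.continuousOn.integrableOn_Icc)).1 h0
    exact Measure.eqOn_Icc_of_ae_eq volume hT.ne h1 hcont.continuousOn continuousOn_const
  refine eq_zero_of_inner_flow_eq_zero hT h fun j s hs => ?_
  have := (Finset.sum_eq_zero_iff_of_nonneg fun j _ => sq_nonneg (φ j s)).1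
    (hzero s (Ioo_subset_Icc_self hs)) j (Finset.mem_univ j)
  exact pow_eq_zero_iff two_ne_zero |>.1 this

/-- Every terminal state is reached by a trajectory that satisfies the mixed constraint with
equality. -/
theorem exists_trajectory (hT : 0 < T) {A : Matrix (Fin n) (Fin n) ℝ} {B : Matrix (Fin n) (Fin m) ℝ}
    {C : Matrix (Fin l) (Fin n) ℝ} {D : Matrix (Fin l) (Fin m) ℝ} {Y : Matrix (Fin m) (Fin r) ℝ}
    (hD : D.rank = l) (hDY : D * Y = 0)
    (hk : (krylovMatrix (A - B * pinv D * C) (B * Y)).rank = n) (f : L2 T l) (a z : Vec n) :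
    ∃ (x : L2 T n) (u : L2 T m),
      (∀ᵐ t ∂(timeMeasure T), x t = a + prim T n t (matL T A x + matL T B u)) ∧
      a + prim T n T (matL T A x + matL T B u) = z ∧ matL T C x + matL T D u - f = 0 := by
  set G := A - B * pinv D * C with hG
  have hTT : T ∈ Icc 0 T := right_mem_Icc.2 hT.le
  have hcf : Continuous fun s => flow (opL G) (-s) := (continuous_flow (opL G)).comp continuous_neg
  have hint : ∀ w : L2 T n, IntervalIntegrable (fun s => flow (opL G) (-s) (w s)) volume 0 T :=
    fun w => intervalIntegrable_clm_apply hcf (w.intervalIntegrable hTT)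
  set h : L2 T n := matL T B (matL T (pinv D) f) with hh
  -- The target is what v must add, pulled back to time 0, after the initial value and the forcing B
  -- D† f are accounted for.
  obtain ⟨v, hv⟩ := exists_control hT hk
    (flow (opL G) (-T) z - a - ∫ s in (0 : ℝ)..T, flow (opL G) (-s) (h s))
  obtain ⟨x, hx, hxT⟩ := exists_solution hT G a (h + matL T (B * Y) v)
  have hsum : ∫ s in (0 : ℝ)..T, flow (opL G) (-s) ((h + matL T (B * Y) v : L2 T n) s)
      = (∫ s in (0 : ℝ)..T, flow (opL G) (-s) (h s))
        + ∫ s in (0 : ℝ)..T, flow (opL G) (-s) (matL T (B * Y) v s) := by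
    rw [← intervalIntegral.integral_add (hint _) (hint _), intervalIntegral.integral_of_le hT.le,
      intervalIntegral.integral_of_le hT.le, integral_Ioc_eq_integral_Ioo,
      integral_Ioc_eq_integral_Ioo]
    refine integral_congr_ae ?_
    filter_upwards [Lp.coeFn_add h (matL T (B * Y) v)] with s hs
    rw [hs, Pi.add_apply, map_add]
  -- The feedback absorbs C x, replacing A by G; `Y v` acts on the state without disturbing the path
  -- constraint, as D Y = 0.
  have e : matL T A x + matL T B (matL T (pinv D) (f - matL T C x) + matL T Y v)
      = matL T G x + (h + matL T (B * Y) v) := by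
    rw [hG, matL_sub, Matrix.mul_assoc, matL_mul B, matL_mul (pinv D), matL_mul B Y, hh, map_add,
      map_sub, map_sub]
    abel
  refine ⟨x, matL T (pinv D) (f - matL T C x) + matL T Y v, ?_, ?_, ?_⟩
  · rw [e]; exact hx
  · rw [e, hxT, hsum, hv]
    have : a + ((∫ s in (0 : ℝ)..T, flow (opL G) (-s) (h s)) + (flow (opL G) (-T) z - a
        - ∫ s in (0 : ℝ)..T, flow (opL G) (-s) (h s))) = flow (opL G) (-T) z := by abel
    rw [this, flow_flow_neg_apply]
  · rw [map_add, ← matL_mul, ← matL_mul, mul_pinv hD, hDY, matL_one, matL_zero]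
    abel

end Controllability

/-! ### Reduction of a Hilbert space minimization to a finite-dimensional one. -/

section Minimization

open Filter Topology

/-- Minimizing a continuous function of a parameter plus the squared distance to a closed convex
set that depends on the parameter in a jointly convex way. -/
theorem exists_min_add_sq_dist {E H : Type*} [NormedAddCommGroup E] [NormedSpace ℝ E]
    [FiniteDimensional ℝ E] [NormedAddCommGroup H] [InnerProductSpace ℝ H] [CompleteSpace H]
    {W : E → Set H} (hne : ∀ z, (W z).Nonempty) (hcl : ∀ z, IsClosed (W z))
    (hconv : ∀ z z' p p' (a b : ℝ), p ∈ W z → p' ∈ W z' → 0 ≤ a → 0 ≤ b → a + b = 1 →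
      a • p + b • p' ∈ W (a • z + b • z'))
    {c : ℝ} (hc : 0 ≤ c) (hbd : ∀ z, ∀ p ∈ W z, ‖z‖ ≤ c * (1 + ‖p‖))
    {S : Set E} (hS : IsClosed S) (hSne : S.Nonempty) {Φ : E → ℝ} (hΦ : Continuous Φ)
    (hb : BddBelow (range Φ)) (p₀ : H) :
    ∃ z ∈ S, ∃ p ∈ W z, ∀ z' ∈ S, ∀ p' ∈ W z',
      Φ z + 1 / 2 * ‖p - p₀‖ ^ 2 ≤ Φ z' + 1 / 2 * ‖p' - p₀‖ ^ 2 := by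
  let φ : E → ℝ := fun z => Metric.infDist p₀ (W z)
  have hatt : ∀ z, ∃ p ∈ W z, ‖p₀ - p‖ = φ z := by
    intro z
    have hcz : Convex ℝ (W z) := by
      intro p hp p' hp' a b ha hb hab
      have := hconv z z p p' a b hp hp' ha hb hab
      rwa [← add_smul, hab, one_smul] at this
    obtain ⟨p, hp, h⟩ := exists_norm_eq_iInf_of_complete_convex (hne z) (hcl z).isComplete hcz p₀
    refine ⟨p, hp, ?_⟩
    rw [h]
    simp only [φ, Metric.infDist_eq_iInf, dist_eq_norm]
  have hφle : ∀ z, ∀ p ∈ W z, φ z ≤ ‖p₀ - p‖ := fun z p hp => by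
    rw [← dist_eq_norm]; exact Metric.infDist_le_dist_of_mem hp
  have hφ0 : ∀ z, 0 ≤ φ z := fun z => Metric.infDist_nonneg
  have hφconv : ConvexOn ℝ univ φ := by
    refine ⟨convex_univ, fun z _ z' _ a b ha hb hab => ?_⟩
    obtain ⟨p, hp, h1⟩ := hatt z
    obtain ⟨p', hp', h2⟩ := hatt z'
    have h3 := hφle _ _ (hconv z z' p p' a b hp hp' ha hb hab)
    refine h3.trans ?_
    have e : p₀ - (a • p + b • p') = a • (p₀ - p) + b • (p₀ - p') := by
      have : p₀ = a • p₀ + b • p₀ := by rw [← add_smul, hab, one_smul]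
      nth_rewrite 1 [this]
      rw [smul_sub, smul_sub]; abel
    rw [e, ← h1, ← h2]
    refine (norm_add_le _ _).trans_eq ?_
    rw [norm_smul, norm_smul, Real.norm_of_nonneg ha, Real.norm_of_nonneg hb]; rfl
  -- A finite convex function on a finite-dimensional space is continuous. Neither `S` nor `Φ` has
  -- to be convex.
  have hφcont : Continuous φ := continuousOn_univ.1 (hφconv.continuousOn isOpen_univ)
  let h : E → ℝ := fun z => Φ z + 1 / 2 * φ z ^ 2
  have hcont : Continuous h := hΦ.add (continuous_const.mul (hφcont.pow 2))
  obtain ⟨z₀, hz₀⟩ := hSne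
  obtain ⟨β, hβ⟩ := hb
  -- If h z ≤ h z₀ then φ z ^ 2 ≤ 2 (h z₀ - β), hence φ z ≤ 1 + 2 (h z₀ - β) and ‖p‖ ≤ ‖p₀‖ + φ z
  -- for the nearest point p; `hbd` then bounds z.
  set R := c * (1 + (‖p₀‖ + (1 + 2 * (h z₀ - β)))) with hR
  have hin : ∀ z, h z ≤ h z₀ → z ∈ Metric.closedBall (0 : E) R := by
    intro z hz
    rw [mem_closedBall_zero_iff]
    obtain ⟨p, hp, h1⟩ := hatt z
    refine (hbd z p hp).trans (mul_le_mul_of_nonneg_left ?_ hc)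
    have h2 : β ≤ Φ z := hβ (mem_range_self z)
    have h3 : φ z ≤ 1 + 2 * (h z₀ - β) := by
      have h4 : Φ z + 1 / 2 * φ z ^ 2 ≤ h z₀ := hz
      nlinarith [sq_nonneg (φ z - 1)]
    have h5 : ‖p‖ ≤ ‖p₀‖ + ‖p₀ - p‖ := by
      have := norm_sub_le p₀ (p₀ - p)
      rwa [sub_sub_cancel] at this
    linarith
  obtain ⟨z, ⟨hz, -⟩, hmin⟩ := ((isCompact_closedBall (0 : E) R).inter_left hS).exists_isMinOn
    ⟨z₀, hz₀, hin z₀ le_rfl⟩ hcont.continuousOn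
  have hmin' : ∀ z' ∈ S, h z ≤ h z' := by
    intro z' hz'
    by_cases hle : h z' ≤ h z₀
    · exact hmin ⟨hz', hin z' hle⟩
    · exact (hmin ⟨hz₀, hin z₀ le_rfl⟩).trans (not_le.1 hle).le
  obtain ⟨p, hp, hpz⟩ := hatt z
  refine ⟨z, hz, p, hp, fun z' hz' p' hp' => ?_⟩
  have h1 : Φ z + 1 / 2 * φ z ^ 2 ≤ Φ z' + 1 / 2 * φ z' ^ 2 := hmin' z' hz'
  have h2 := pow_le_pow_left₀ (hφ0 z') (hφle z' p' hp') 2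
  rw [norm_sub_rev p p₀, norm_sub_rev p' p₀, hpz]
  linarith

end Minimization

/-! ### Closedness and joint convexity of the trajectory sets. -/

section Trajectories

open Filter Topology

variable {T : ℝ} {n m l : ℕ}

/-- The pairs `(x,u)` with `x' = A x + B u`, `x(0) = a`, `x(T) = z` and `C x + D u ≤ f`. -/
def trajectories (A : Matrix (Fin n) (Fin n) ℝ) (B : Matrix (Fin n) (Fin m) ℝ)
    (C : Matrix (Fin l) (Fin n) ℝ) (D : Matrix (Fin l) (Fin m) ℝ) (f : L2 T l) (a z : Vec n) :
    Set (L2 T n × L2 T m) :=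
  {p | (∀ᵐ t ∂(timeMeasure T), p.1 t = a + prim T n t (matL T A p.1 + matL T B p.2)) ∧
    a + prim T n T (matL T A p.1 + matL T B p.2) = z ∧
    ∀ᵐ t ∂(timeMeasure T), ∀ i, (matL T C p.1 + matL T D p.2 - f : L2 T l) t i ≤ 0}

theorem exists_subseq_tendsto_ae {w : ℕ → L2 T n} {v : L2 T n} (h : Tendsto w atTop (𝓝 v)) :
    ∃ φ : ℕ → ℕ, StrictMono φ ∧
      ∀ᵐ t ∂(timeMeasure T), Tendsto (fun k => w (φ k) t) atTop (𝓝 (v t)) :=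
  (tendstoInMeasure_of_tendsto_Lp h).exists_seq_tendsto_ae

/-- The integral terms converge for every t by continuity of `prim`; the pointwise conditions pass
to the limit along an a.e. convergent subsequence. -/
theorem isClosed_trajectories (A : Matrix (Fin n) (Fin n) ℝ) (B : Matrix (Fin n) (Fin m) ℝ)
    (C : Matrix (Fin l) (Fin n) ℝ) (D : Matrix (Fin l) (Fin m) ℝ) (f : L2 T l) (a z : Vec n) :
    IsClosed (trajectories A B C D f a z) := by
  refine IsSeqClosed.isClosed fun w p hw hlim => ?_
  have h1 : Tendsto (fun k => (w k).1) atTop (𝓝 p.1) := (continuous_fst.tendsto p).comp hlim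
  have h2 : Tendsto (fun k => (w k).2) atTop (𝓝 p.2) := (continuous_snd.tendsto p).comp hlim
  have hg : Tendsto (fun k => matL T A (w k).1 + matL T B (w k).2) atTop
      (𝓝 (matL T A p.1 + matL T B p.2)) :=
    (((matL T A).continuous.tendsto _).comp h1).add (((matL T B).continuous.tendsto _).comp h2)
  have hprim : ∀ t, Tendsto (fun k => a + prim T n t (matL T A (w k).1 + matL T B (w k).2)) atTop
      (𝓝 (a + prim T n t (matL T A p.1 + matL T B p.2))) := fun t =>
    (((prim T n t).continuous.tendsto _).comp hg).const_add a
  have hc : Tendsto (fun k => matL T C (w k).1 + matL T D (w k).2 - f) atTop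
      (𝓝 (matL T C p.1 + matL T D p.2 - f)) :=
    ((((matL T C).continuous.tendsto _).comp h1).add
      (((matL T D).continuous.tendsto _).comp h2)).sub_const f
  refine ⟨?_, ?_, ?_⟩
  · obtain ⟨φ, hφ, hae⟩ := exists_subseq_tendsto_ae h1
    filter_upwards [hae, ae_all_iff.2 fun k => (hw k).1] with t ht hwt
    refine tendsto_nhds_unique ht ?_
    simp only [hwt]
    exact (hprim t).comp hφ.tendsto_atTop
  · exact tendsto_nhds_unique (hprim T) (tendsto_const_nhds.congr fun k => ((hw k).2.1).symm)
  · obtain ⟨φ, hφ, hae⟩ := exists_subseq_tendsto_ae hc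
    filter_upwards [hae, ae_all_iff.2 fun k => (hw k).2.2] with t ht hwt i
    refine le_of_tendsto' (((EuclideanSpace.proj (𝕜 := ℝ) i).continuous.tendsto _).comp ht)
      fun k => hwt _ i

/-- Convexity jointly in the end point and the pair is what makes the distance to the trajectory set
a convex function of the end point. -/
theorem add_mem_trajectories {A : Matrix (Fin n) (Fin n) ℝ} {B : Matrix (Fin n) (Fin m) ℝ}
    {C : Matrix (Fin l) (Fin n) ℝ} {D : Matrix (Fin l) (Fin m) ℝ} {f : L2 T l} {a z z' : Vec n}
    {p p' : L2 T n × L2 T m} {α β : ℝ} (hp : p ∈ trajectories A B C D f a z)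
    (hp' : p' ∈ trajectories A B C D f a z') (hα : 0 ≤ α) (hβ : 0 ≤ β) (hαβ : α + β = 1) :
    α • p + β • p' ∈ trajectories A B C D f a (α • z + β • z') := by
  have ha : a = α • a + β • a := by rw [← add_smul, hαβ, one_smul]
  have hf : f = α • f + β • f := by rw [← add_smul, hαβ, one_smul]
  have hg : matL T A (α • p + β • p').1 + matL T B (α • p + β • p').2
      = α • (matL T A p.1 + matL T B p.2) + β • (matL T A p'.1 + matL T B p'.2) := by
    simp only [Prod.fst_add, Prod.snd_add, Prod.smul_fst, Prod.smul_snd, map_add, map_smul,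
      smul_add]
    abel
  have hc : matL T C (α • p + β • p').1 + matL T D (α • p + β • p').2 - f
      = α • (matL T C p.1 + matL T D p.2 - f) + β • (matL T C p'.1 + matL T D p'.2 - f) := by
    conv_lhs => rw [hf]
    simp only [Prod.fst_add, Prod.snd_add, Prod.smul_fst, Prod.smul_snd, map_add, map_smul,
      smul_add, smul_sub]
    abel
  have hprim : ∀ t, a + prim T n t
        (matL T A (α • p + β • p').1 + matL T B (α • p + β • p').2)
      = α • (a + prim T n t (matL T A p.1 + matL T B p.2))
        + β • (a + prim T n t (matL T A p'.1 + matL T B p'.2)) := by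
    intro t
    rw [hg, map_add, map_smul, map_smul, smul_add, smul_add]
    nth_rewrite 1 [ha]
    abel
  have hcoe : ∀ {k : ℕ} (v w : L2 T k), ∀ᵐ t ∂(timeMeasure T),
      (α • v + β • w : L2 T k) t = α • v t + β • w t := fun v w => by
    filter_upwards [Lp.coeFn_add (α • v) (β • w), Lp.coeFn_smul α v, Lp.coeFn_smul β w]
      with t h1 h2 h3
    rw [h1, Pi.add_apply, h2, h3, Pi.smul_apply, Pi.smul_apply]
  refine ⟨?_, ?_, ?_⟩
  · filter_upwards [hp.1, hp'.1, hcoe p.1 p'.1] with t h1 h2 h3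
    rw [hprim, ← h1, ← h2]
    exact h3
  · rw [hprim, hp.2.1, hp'.2.1]
  · rw [hc]
    filter_upwards [hp.2.2, hp'.2.2, hcoe (matL T C p.1 + matL T D p.2 - f)
      (matL T C p'.1 + matL T D p'.2 - f)] with t h1 h2 h3 i
    rw [h3, PiLp.add_apply, PiLp.smul_apply, PiLp.smul_apply, smul_eq_mul, smul_eq_mul]
    have := mul_nonpos_of_nonneg_of_nonpos hα (h1 i)
    have := mul_nonpos_of_nonneg_of_nonpos hβ (h2 i)
    linarith

/-- Minimizing a function of the terminal state plus the tracking and control costs. -/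
theorem exists_optimal_trajectory {A : Matrix (Fin n) (Fin n) ℝ} {B : Matrix (Fin n) (Fin m) ℝ}
    {C : Matrix (Fin l) (Fin n) ℝ} {D : Matrix (Fin l) (Fin m) ℝ} {f : L2 T l} {a : Vec n}
    (hne : ∀ z, (trajectories A B C D f a z).Nonempty) {S : Set (Vec n)} (hS : IsClosed S)
    (hSne : S.Nonempty) {Φ : Vec n → ℝ} (hΦ : Continuous Φ) (hb : BddBelow (range Φ)) {δ : ℝ}
    (hδ : 0 < δ) (xd : L2 T n) (ud : L2 T m) :
    ∃ z ∈ S, ∃ p ∈ trajectories A B C D f a z, ∀ z' ∈ S, ∀ p' ∈ trajectories A B C D f a z',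
      Φ z + 1 / 2 * ‖p.1 - xd‖ ^ 2 + δ / 2 * ‖p.2 - ud‖ ^ 2
        ≤ Φ z' + 1 / 2 * ‖p'.1 - xd‖ ^ 2 + δ / 2 * ‖p'.2 - ud‖ ^ 2 := by
  have hs : 0 < √δ := Real.sqrt_pos.2 hδ
  -- Scaling the control by √δ in the Hilbert product merges both costs into one squared distance;
  -- the plain product carries the sup norm. `J` undoes the scaling `I`.
  let J : WithLp 2 (L2 T n × L2 T m) →L[ℝ] L2 T n × L2 T m :=
    ((ContinuousLinearMap.fst ℝ (L2 T n) (L2 T m)).prod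
      ((√δ)⁻¹ • ContinuousLinearMap.snd ℝ (L2 T n) (L2 T m))) ∘L
      (WithLp.prodContinuousLinearEquiv 2 ℝ (L2 T n) (L2 T m)).toContinuousLinearMap
  let I : L2 T n × L2 T m → WithLp 2 (L2 T n × L2 T m) := fun p => WithLp.toLp 2 (p.1, √δ • p.2)
  have hJI : ∀ p, J (I p) = p := fun p => by
    show (p.1, (√δ)⁻¹ • √δ • p.2) = p
    rw [inv_smul_smul₀ hs.ne']
  let g : L2 T n × L2 T m →L[ℝ] Vec n :=
    prim T n T ∘L (matL T A ∘L ContinuousLinearMap.fst ℝ (L2 T n) (L2 T m)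
      + matL T B ∘L ContinuousLinearMap.snd ℝ (L2 T n) (L2 T m))
  have hcost : ∀ p : WithLp 2 (L2 T n × L2 T m), 1 / 2 * ‖p - I (xd, ud)‖ ^ 2
      = 1 / 2 * ‖(J p).1 - xd‖ ^ 2 + δ / 2 * ‖(J p).2 - ud‖ ^ 2 := by
    intro p
    rw [WithLp.prod_norm_sq_eq_of_L2]
    have e1 : (p - I (xd, ud)).fst = (J p).1 - xd := rfl
    have e2 : (p - I (xd, ud)).snd = √δ • ((J p).2 - ud) := by
      show p.snd - √δ • ud = √δ • ((√δ)⁻¹ • p.snd - ud)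
      rw [smul_sub, smul_inv_smul₀ hs.ne']
    rw [e1, e2, norm_smul, mul_pow, Real.norm_of_nonneg hs.le, Real.sq_sqrt hδ.le]
    ring
  obtain ⟨z, hz, p, hp, hmin⟩ := exists_min_add_sq_dist
    (W := fun z => J ⁻¹' trajectories A B C D f a z)
    (fun z => let ⟨p, hp⟩ := hne z; ⟨I p, by rw [mem_preimage, hJI]; exact hp⟩)
    (fun z => (isClosed_trajectories A B C D f a z).preimage J.continuous)
    (fun z z' p p' α β hp hp' hα hβ hαβ => by
      rw [mem_preimage, map_add, map_smul, map_smul]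
      exact add_mem_trajectories hp hp' hα hβ hαβ)
    (c := ‖a‖ + ‖g ∘L J‖) (by positivity)
    (fun z p hp => by
      have e : z = a + (g ∘L J) p := hp.2.1.symm
      rw [e]
      have h1 := norm_add_le a ((g ∘L J) p)
      have h2 := (g ∘L J).le_opNorm p
      nlinarith [norm_nonneg a, norm_nonneg p, norm_nonneg (g ∘L J),
        mul_nonneg (norm_nonneg a) (norm_nonneg p)])
    hS hSne hΦ hb (I (xd, ud))
  refine ⟨z, hz, J p, hp, fun z' hz' p' hp' => ?_⟩
  have h := hmin z' hz' (I p') (by rw [mem_preimage, hJI]; exact hp')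
  rw [hcost, hcost, hJI] at h
  linarith

end Trajectories

/-! ### Expected data, the terminal set, and feasible pairs as trajectories. -/

namespace Problem

open Filter Topology

variable {Ω : Type*} [MeasurableSpace Ω] {P : Measure Ω} {d n m l k : ℕ}
  {p : Problem P d n m l k} {κ₁ κ₂ κ₃ κ₄ : range p.ξ → ℝ}

theorem measurable_sample (p : Problem P d n m l k) : Measurable p.sample :=
  p.measurable_ξ.subtype_mk

theorem measurable_toEuclideanLin (p : Problem P d n m l k) (z : Vec n) :
    Measurable fun s => Matrix.toEuclideanLin (p.M s) z := by
  refine (PiLp.continuous_toLp 2 _).measurable.comp (measurable_pi_lambda _ fun i => ?_)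
  show Measurable fun s => ∑ j, p.M s i j * z j
  exact Finset.measurable_sum _ fun j _ => (p.measurable_M i j).mul_const _

theorem GrowthBounds.norm_toEuclideanLin_le (hκ : p.GrowthBounds κ₁ κ₂ κ₃ κ₄) (s : range p.ξ)
    (z : Vec n) : ‖Matrix.toEuclideanLin (p.M s) z‖ ≤ κ₃ s * ‖z‖ :=
  ((Matrix.toEuclideanCLM (𝕜 := ℝ) (p.M s)).le_opNorm z).trans
    (mul_le_mul_of_nonneg_right (hκ.bound_M s) (norm_nonneg z))

theorem GrowthBounds.integrable_M_apply (hκ : p.GrowthBounds κ₁ κ₂ κ₃ κ₄) (z : Vec n) :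
    Integrable (fun ω => Matrix.toEuclideanLin (p.M (p.sample ω)) z) P :=
  (hκ.integrable₃.mul_const ‖z‖).mono'
    ((p.measurable_toEuclideanLin z).comp p.measurable_sample).aestronglyMeasurable
    (.of_forall fun _ => hκ.norm_toEuclideanLin_le _ z)

theorem GrowthBounds.integrable_q (hκ : p.GrowthBounds κ₁ κ₂ κ₃ κ₄) :
    Integrable (fun ω => p.q (p.sample ω)) P :=
  hκ.integrable₄.mono' (p.measurable_q.comp p.measurable_sample).aestronglyMeasurable
    (.of_forall fun _ => hκ.bound_q _)

theorem GrowthBounds.integrable_M_entry (hκ : p.GrowthBounds κ₁ κ₂ κ₃ κ₄) (i j : Fin n) :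
    Integrable (fun ω => p.M (p.sample ω) i j) P := by
  have h := (EuclideanSpace.proj (𝕜 := ℝ) i).integrable_comp
    (hκ.integrable_M_apply (EuclideanSpace.single j 1))
  refine h.congr (.of_forall fun ω => ?_)
  simp [Matrix.toLpLin_apply]

theorem GrowthBounds.lcpMap_apply (hκ : p.GrowthBounds κ₁ κ₂ κ₃ κ₄) (z : Vec n) (i : Fin n) :
    p.lcpMap z i = (p.meanM.mulVec z.ofLp + p.meanQ.ofLp) i := by
  rw [lcpMap, integral_add (hκ.integrable_M_apply z) hκ.integrable_q, PiLp.add_apply, Pi.add_apply]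
  congr 1
  have h := (EuclideanSpace.proj (𝕜 := ℝ) i).integral_comp_comm (hκ.integrable_M_apply z)
  refine h.symm.trans ?_
  have e : ∀ ω, (EuclideanSpace.proj (𝕜 := ℝ) i) (Matrix.toEuclideanLin (p.M (p.sample ω)) z)
      = ∑ j, p.M (p.sample ω) i j * z j := fun ω => rfl
  simp only [e]
  rw [integral_finsetSum _ fun j _ => (hκ.integrable_M_entry i j).mul_const _]
  simp only [integral_mul_const]
  rfl

theorem GrowthBounds.continuous_lcpMap (hκ : p.GrowthBounds κ₁ κ₂ κ₃ κ₄) :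
    Continuous p.lcpMap := by
  have e : p.lcpMap = fun z => WithLp.toLp 2 (p.meanM.mulVec z.ofLp + p.meanQ.ofLp) := by
    funext z; ext i; exact hκ.lcpMap_apply z i
  rw [e]
  exact (PiLp.continuous_toLp 2 _).comp
    ((Continuous.matrix_mulVec continuous_const (PiLp.continuous_ofLp 2 _)).add continuous_const)

/-- Lipschitz with constant E[κ₁]. Integrability for every z is essential, since the integral of a
nonintegrable function is 0 by convention. -/
theorem GrowthBounds.continuous_meanF (hκ : p.GrowthBounds κ₁ κ₂ κ₃ κ₄)
    (hF : ∀ z, Integrable (fun ω => p.F z (p.sample ω)) P) : Continuous p.meanF := by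
  have hnn : 0 ≤ ∫ ω, κ₁ (p.sample ω) ∂P := integral_nonneg fun _ => hκ.nonneg₁ _
  refine (LipschitzWith.of_dist_le_mul (K := ⟨_, hnn⟩) fun z₁ z₂ => ?_).continuous
  rw [dist_eq_norm, meanF, meanF, ← integral_sub (hF z₁) (hF z₂), dist_eq_norm]
  show _ ≤ (∫ ω, κ₁ (p.sample ω) ∂P) * _
  rw [← integral_mul_const]
  refine norm_integral_le_of_norm_le (hκ.integrable₁.mul_const ‖z₁ - z₂‖) ?_
  simpa only [Real.norm_eq_abs] using hκ.lipschitz_F z₁ z₂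

theorem aestronglyMeasurable_g (p : Problem P d n m l k) (z : Vec n) :
    AEStronglyMeasurable (fun ω => p.g z (p.sample ω)) P :=
  ((p.measurable_g z).comp p.measurable_sample).aestronglyMeasurable

/-- For g only growth is controlled, so continuity comes from dominated convergence, with a bound
valid on a neighbourhood of z₀. -/
theorem GrowthBounds.continuous_meanG (hκ : p.GrowthBounds κ₁ κ₂ κ₃ κ₄) :
    Continuous p.meanG := by
  refine continuous_iff_continuousAt.2 fun z₀ => ?_
  refine continuousAt_of_dominated (bound := fun ω => κ₂ (p.sample ω) * (‖z₀‖ + 1))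
    (.of_forall fun z => p.aestronglyMeasurable_g z) ?_ (hκ.integrable₂.mul_const _) ?_
  · have : ∀ᶠ z in 𝓝 z₀, ‖z‖ < ‖z₀‖ + 1 :=
      (continuous_norm.tendsto z₀).eventually (gt_mem_nhds (lt_add_one _))
    filter_upwards [this] with z hz
    filter_upwards [hκ.bound_g z] with ω hω
    exact hω.trans (mul_le_mul_of_nonneg_left hz.le (hκ.nonneg₂ _))
  · filter_upwards [p.contDiff_g] with ω hω
    exact hω.continuous.continuousAt

theorem GrowthBounds.norm_meanG_le (hκ : p.GrowthBounds κ₁ κ₂ κ₃ κ₄) (z : Vec n) :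
    ‖p.meanG z‖ ≤ (∫ ω, κ₂ (p.sample ω) ∂P) * ‖z‖ := by
  rw [← integral_mul_const]
  exact norm_integral_le_of_norm_le (hκ.integrable₂.mul_const _) (hκ.bound_g z)

/-- The terminal states that satisfy the complementarity and the cone constraints. -/
def terminalSet (p : Problem P d n m l k) : Set (Vec n) :=
  {z | (∀ i, 0 ≤ z i) ∧ (∀ i, 0 ≤ p.lcpMap z i) ∧ inner ℝ z (p.lcpMap z) = 0 ∧ p.meanG z ∈ p.K}

theorem GrowthBounds.isClosed_terminalSet (hκ : p.GrowthBounds κ₁ κ₂ κ₃ κ₄) :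
    IsClosed p.terminalSet := by
  have hproj : ∀ i : Fin n, Continuous fun z : Vec n => z i := fun i =>
    (EuclideanSpace.proj (𝕜 := ℝ) i).continuous
  have h1 : IsClosed {z : Vec n | ∀ i, 0 ≤ z i} := by
    simp only [Set.ofPred_forall]
    exact isClosed_iInter fun i => isClosed_le continuous_const (hproj i)
  have h2 : IsClosed {z : Vec n | ∀ i, 0 ≤ p.lcpMap z i} := h1.preimage hκ.continuous_lcpMap
  have h3 : IsClosed {z : Vec n | inner ℝ z (p.lcpMap z) = 0} :=
    isClosed_eq (continuous_id.inner hκ.continuous_lcpMap) continuous_const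
  have h4 : IsClosed {z : Vec n | p.meanG z ∈ p.K} := p.K_closed.preimage hκ.continuous_meanG
  exact h1.inter (h2.inter (h3.inter h4))

theorem norm_le_sum_abs (z : Vec n) : ‖z‖ ≤ ∑ i, |z i| := by
  have h : z = ∑ j, z j • EuclideanSpace.single j (1 : ℝ) := by
    ext k; simp [Finset.sum_apply, Pi.single_apply]
  conv_lhs => rw [h]
  refine (norm_sum_le _ _).trans (Finset.sum_le_sum fun i _ => ?_)
  rw [norm_smul, PiLp.norm_single]
  simp

/-- The complementarity solution with nonsingular support has Euclidean norm at most β‖E[q]‖₁;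
multiplied by E[κ₂] this is the radius of the ball in K. -/
theorem GrowthBounds.nonempty_terminalSet (hκ : p.GrowthBounds κ₁ κ₂ κ₃ κ₄)
    (hball : Metric.closedBall (0 : Vec k)
      (beta p.meanM * (∫ ω, κ₂ (p.sample ω) ∂P) * ∑ i, |p.meanQ i|) ⊆ p.K)
    (hV : {v : Vec n | (∀ i, 0 ≤ p.lcpMap v i) ∧ ∀ i, 0 ≤ v i}.Nonempty)
    (hM : IsAdequate p.meanM ∨ IsZMatrix p.meanM) : p.terminalSet.Nonempty := by
  obtain ⟨v, hv1, hv2⟩ := hV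
  obtain ⟨z, hz, hns⟩ := exists_lcpSolution_nonsingular hM (q := p.meanQ.ofLp)
    ⟨v.ofLp, fun i => ⟨hv2 i, by rw [← hκ.lcpMap_apply]; exact hv1 i⟩⟩
  have hl : ∀ i, p.lcpMap (WithLp.toLp 2 z) i = (p.meanM.mulVec z + p.meanQ.ofLp) i := fun i =>
    hκ.lcpMap_apply (WithLp.toLp 2 z) i
  refine ⟨WithLp.toLp 2 z, fun i => (hz i).1, fun i => ?_, ?_, hball ?_⟩
  · rw [hl]; exact (hz i).2.1
  · rw [PiLp.inner_apply]
    refine Finset.sum_eq_zero fun i _ => ?_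
    rw [hl]
    have := (hz i).2.2
    simpa [mul_comm] using this
  · rw [mem_closedBall_zero_iff]
    have h1 : ‖(WithLp.toLp 2 z : Vec n)‖ ≤ beta p.meanM * ∑ i, |p.meanQ i| :=
      (norm_le_sum_abs _).trans (hz.sum_abs_le hns)
    refine (hκ.norm_meanG_le _).trans ?_
    have h2 : 0 ≤ ∫ ω, κ₂ (p.sample ω) ∂P := integral_nonneg fun _ => hκ.nonneg₂ _
    refine (mul_le_mul_of_nonneg_left h1 h2).trans_eq (by ring)

/-- The pairs of a state and a control that reach `z` and satisfy the path constraint. -/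
def trajectorySet (p : Problem P d n m l k) (z : Vec n) : Set (L2 p.T n × L2 p.T m) :=
  trajectories p.A p.B p.C p.D p.f p.x₀ z

theorem coeFn_path (p : Problem P d n m l k) (x : L2 p.T n) (u : L2 p.T m) :
    ∀ᵐ t ∂(timeMeasure p.T), (matL p.T p.C x + matL p.T p.D u - p.f : L2 p.T l) t
      = Matrix.toEuclideanLin p.C (x t) + Matrix.toEuclideanLin p.D (u t) - p.f t := by
  filter_upwards [Lp.coeFn_sub (matL p.T p.C x + matL p.T p.D u) p.f,
    Lp.coeFn_add (matL p.T p.C x) (matL p.T p.D u), coeFn_matL p.C x, coeFn_matL p.D u]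
    with t h1 h2 h3 h4
  rw [h1, Pi.sub_apply, h2, Pi.add_apply, h3, h4]

theorem coeFn_dynamics (p : Problem P d n m l k) (x : L2 p.T n) (u : L2 p.T m) :
    ∀ᵐ t ∂(timeMeasure p.T), (matL p.T p.A x + matL p.T p.B u : L2 p.T n) t
      = Matrix.toEuclideanLin p.A (x t) + Matrix.toEuclideanLin p.B (u t) := by
  filter_upwards [Lp.coeFn_add (matL p.T p.A x) (matL p.T p.B u), coeFn_matL p.A x,
    coeFn_matL p.B u] with t h2 h3 h4
  rw [h2, Pi.add_apply, h3, h4]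

theorem exists_isFeasible_of_mem {z : Vec n} (hz : z ∈ p.terminalSet)
    {w : L2 p.T n × L2 p.T m} (hw : w ∈ p.trajectorySet z) :
    ∃ x : H1 p.T n, x.toL2 = w.1 ∧ x.rep p.T = z ∧ p.IsFeasible x w.2 := by
  obtain ⟨x, hx, hdx, h0, hT⟩ := exists_H1_of_primitive p.T_pos hw.1
  have hTz : x.rep p.T = z := hT.trans hw.2.1
  refine ⟨x, hx, hTz, ?_, ?_, h0, ?_, ?_, ?_, ?_⟩
  · rw [hdx, hx]; exact p.coeFn_dynamics w.1 w.2
  · rw [hx]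
    filter_upwards [p.coeFn_path w.1 w.2, hw.2.2] with t h1 h2 i
    rw [← h1]; exact h2 i
  all_goals rw [hTz]
  exacts [hz.1, hz.2.1, hz.2.2.1, hz.2.2.2]

/-- Converse of `exists_isFeasible_of_mem`: a minimum over terminal states and trajectories is thus
a minimum over all feasible pairs. -/
theorem IsFeasible.mem_trajectorySet {x : H1 p.T n} {u : L2 p.T m} (h : p.IsFeasible x u) :
    x.rep p.T ∈ p.terminalSet ∧ (x.toL2, u) ∈ p.trajectorySet (x.rep p.T) := by
  refine ⟨⟨h.terminal_nonneg, h.terminal_lcp_nonneg, h.terminal_orthogonal, h.terminal_mem⟩, ?_⟩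
  have hd : x.deriv = matL p.T p.A x.toL2 + matL p.T p.B u := by
    refine Lp.ext ?_
    filter_upwards [h.dynamics, p.coeFn_dynamics x.toL2 u] with t h1 h2
    rw [h1, h2]
  refine ⟨?_, ?_, ?_⟩
  · have := x.toL2_eq_primitive p.T_pos
    rwa [h.initial, hd] at this
  · have := x.rep_eq_primitive p.T_pos p.T (right_mem_Icc.2 p.T_pos.le)
    rw [h.initial, hd] at this
    exact this.symm
  · filter_upwards [p.coeFn_path x.toL2 u, h.path] with t h1 h2 i
    rw [h1]; exact h2 i

theorem Controllable.nonempty_trajectorySet (h : p.Controllable) (z : Vec n) :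
    (p.trajectorySet z).Nonempty := by
  obtain ⟨-, hD, Y, -, hDY, hk⟩ := h
  obtain ⟨x, u, hx, hxT, hpath⟩ := exists_trajectory p.T_pos hD hDY hk p.f p.x₀ z
  refine ⟨(x, u), hx, hxT, ?_⟩
  rw [hpath]
  filter_upwards [Lp.coeFn_zero (Vec l) 2 (timeMeasure p.T)] with t ht i
  rw [ht]; simp

end Problem

end TerminalSLCC

/-! ### The existence theorem. -/

theorem theorem2p1 {Ω : Type*} [MeasurableSpace Ω] (P : Measure Ω) [IsProbabilityMeasure P]
    {d n m l k : ℕ} (p : TerminalSLCC.Problem P d n m l k)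
    (κ₁ κ₂ κ₃ κ₄ : range p.ξ → ℝ)
    (hκ : p.GrowthBounds κ₁ κ₂ κ₃ κ₄)
    (hctrl : p.Controllable)
    (hball : Metric.closedBall (0 : TerminalSLCC.Vec k)
      (TerminalSLCC.beta p.meanM * (∫ ω, κ₂ (p.sample ω) ∂P) * ∑ i, |p.meanQ i|) ⊆ p.K)
    (hV : {v : TerminalSLCC.Vec n | (∀ i, 0 ≤ p.lcpMap v i) ∧ ∀ i, 0 ≤ v i}.Nonempty)
    (hM : TerminalSLCC.IsAdequate p.meanM ∨ TerminalSLCC.IsZMatrix p.meanM) :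
    (∃ (x : TerminalSLCC.H1 p.T n) (u : TerminalSLCC.L2 p.T m), p.IsFeasible x u) ∧
    ((∀ z : TerminalSLCC.Vec n, Integrable (fun ω => p.F z (p.sample ω)) P) →
      BddBelow (range p.meanF) →
      ∃ (x : TerminalSLCC.H1 p.T n) (u : TerminalSLCC.L2 p.T m), p.IsOptimal x u) := by
  have hne := hκ.nonempty_terminalSet hball hV hM
  refine ⟨?_, fun hF hb => ?_⟩
  · obtain ⟨z, hz⟩ := hne
    obtain ⟨w, hw⟩ := hctrl.nonempty_trajectorySet z
    obtain ⟨x, -, -, hx⟩ := TerminalSLCC.Problem.exists_isFeasible_of_mem hz hw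
    exact ⟨x, w.2, hx⟩
  · obtain ⟨z, hz, w, hw, hmin⟩ := TerminalSLCC.exists_optimal_trajectory
      hctrl.nonempty_trajectorySet hκ.isClosed_terminalSet hne (hκ.continuous_meanF hF) hb
      p.δ_pos p.xd p.ud
    obtain ⟨x, hx, hxT, hfeas⟩ := TerminalSLCC.Problem.exists_isFeasible_of_mem hz hw
    refine ⟨x, w.2, hfeas, fun y v hyv => ?_⟩
    obtain ⟨hy, hyw⟩ := hyv.mem_trajectorySet
    have := hmin _ hy _ hyw
    rw [TerminalSLCC.Problem.objective, TerminalSLCC.Problem.objective, hx, hxT]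
    exact this
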